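/- Let $G$ be a finite plane cubic simple graph (not necessarily connected), considered up to its combinatorial data on the sphere: the cyclic order of the edges at each vertex and the faces. Let $\mathcal F_G$ be its set of faces. Two distinct faces are adjacent if they share an edge, and a set of faces is connected if it is non-empty and any two of its members are joined by a sequence of successively adjacent faces of the set. A perforated patch of $G$ is a connected proper subset $\mathcal P\subsetneq\mathcal F_G$; it is a patch if $\mathcal F_G\setminus\mathcal P$ is connected as well. The skeleton $G(\mathcal P)$ is the graph of all vertices and edges incident with a face of $\mathcal P$. The perimeters of $\mathcal P$ are the cycles formed by its boundary edges, that is, the edges with a face of $\mathcal P$ on one side and a face outside $\mathcal P$ on the other. Let $C_1,\dots,C_k$ be all the perimeters of $\mathcal P$. The altan operation at $C_j$, where $u_1,\dots,u_d$ are the degree-2 vertices of $C_j$ in cyclic order ($d\ge 2$), adds a new cycle $C_j'=(u_1',u_1'',u_2',u_2'',\dots,u_d',u_d'')$ and the spokes $u_iu_i'$, adds to the set of faces the $d$ faces between $C_j$ and $C_j'$ (the $i$-th bounded by the part of $C_j$ from $u_i$ to $u_{i+1}$ followed by $u_{i+1}',u_i'',u_i'$), and replaces the perimeter $C_j$ by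 $C_j'$. For $J\subseteq\{1,\dots,k\}$ the generalised altan $A(\,\cdot\,;J)$ performs this at every $C_j$, $j\in J$. For $\mathbf n=(n_1,\dots,n_k)$ with integers $n_i\ge 0$, the generalised altan $A^{\mathbf n}(\mathcal P)$ is defined by $A^{\mathbf 0}(\mathcal P)=\mathcal P$ and $A^{\mathbf n}(\mathcal P)=A^{\mathbf n^\dagger}\big(A(\mathcal P;\{i: n_i>0\})\big)$, where $n_i^\dagger=\max(n_i-1,0)$. Its skeleton is the graph $G(A^{\mathbf n}(\mathcal P))$ obtained in this way. Let $\mathcal P$ be a perforated patch, and suppose that every perimeter $C_i$ with $n_i>0$ contains at least two vertices that have degree 2 in $G(\mathcal P)$. Then: 1. $A^{\mathbf n}(\mathcal P)$ is a perforated patch: there are a finite plane cubic graph $G'$ and a perforated patch $\mathcal P'$ of $G'$ whose skeleton, faces (with their boundary walks) and labelled perimeters are those of $A^{\mathbf n}(\mathcal P)$, up to renaming the vertices. 2. If $G(\mathcal P)$ is 2-connected, then $G(A^{\mathbf n}(\mathcal P))$ is 2-connected. 3. If $\mathcal P$ is a patch, then $A^{\mathbf n}(\mathcal P)$ is a patch,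 i.e. in 1. one can choose $\mathcal P'$ to be a patch of $G'$. -/

import Mathlib

universe u

/-- A finite plane cubic simple graph (not necessarily connected), up to isotopy on the sphere.
It is given by the combinatorial data of the drawing: the cyclic order `rot` of the darts (directed
edges) leaving each vertex, and, for each dart, the face `face d` lying on its left.  Travelling
along a dart `d` with a face on the left, the next dart on the boundary of that face is
`rot d.symm` (so `rot` is the clockwise order).  The boundary of a face may consist of several
closed walks, as happens for disconnected graphs.  Such data come from a drawing on the sphere
exactly when the dual graph is connected and Euler's formula `|V| - |E| + |F| = 1 + c` holds,
where `c` is the number of connected components of the graph. -/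
structure PlaneCubicGraph (V F : Type u) where
  graph : SimpleGraph V
  finite_vert : Finite V
  cubic : ∀ v, (graph.neighborSet v).ncard = 3
  /-- the cyclic order of the darts around their common tail -/
  rot : Equiv.Perm graph.Dart
  sameCycle_rot_iff : ∀ d e : graph.Dart, rot.SameCycle d e ↔ d.fst = e.fst
  /-- the face on the left of a dart -/
  face : graph.Dart → F
  face_surjective : Function.Surjective face
  face_rot_symm : ∀ d : graph.Dart, face (rot d.symm) = face d
  dual_preconnected :
    (SimpleGraph.fromRel fun a b : F => ∃ d, face d = a ∧ face d.symm = b).Preconnected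
  euler : Nat.card V + Nat.card F =
    graph.edgeSet.ncard + 1 + Nat.card graph.ConnectedComponent

namespace PlaneCubicGraph

variable {V F : Type u} (G : PlaneCubicGraph V F)

/-- Two distinct faces are adjacent if they share an edge. -/
def dual : SimpleGraph F :=
  SimpleGraph.fromRel fun a b : F => ∃ d, G.face d = a ∧ G.face d.symm = b

/-- A perforated patch: a proper set of faces that is connected (in particular non-empty). -/
def IsPerforatedPatch (P : Set F) : Prop :=
  P ≠ Set.univ ∧ (G.dual.induce P).Connected

/-- A patch: a proper connected set of faces whose complement is connected as well. -/
def IsPatch (P : Set F) : Prop :=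
  G.IsPerforatedPatch P ∧ (G.dual.induce Pᶜ).Connected

/-- The skeleton of a set of faces: the vertices and edges incident with at least one of them. -/
def skeleton (P : Set F) : G.graph.Subgraph where
  verts := {v | ∃ d : G.graph.Dart, d.fst = v ∧ G.face d ∈ P}
  Adj u v := ∃ d : G.graph.Dart, d.fst = u ∧ d.snd = v ∧ (G.face d ∈ P ∨ G.face d.symm ∈ P)
  adj_sub := by
    rintro u v ⟨d, rfl, rfl, -⟩
    exact d.adj
  edge_vert := by
    rintro u v ⟨d, rfl, rfl, h | h⟩
    · exact ⟨d, rfl, h⟩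
    · refine ⟨G.rot d, ?_, ?_⟩
      · exact ((G.sameCycle_rot_iff _ _).1 ⟨1, by simp⟩ : d.fst = (G.rot d).fst).symm
      · have := G.face_rot_symm d.symm
        rw [SimpleGraph.Dart.symm_symm] at this
        rwa [this]
  symm := ⟨by
    rintro u v ⟨d, rfl, rfl, h⟩
    refine ⟨d.symm, rfl, rfl, ?_⟩
    rw [SimpleGraph.Dart.symm_symm]
    exact h.symm⟩

/-- `c` is (the cyclic sequence of vertices of) one of the closed walks that bound the face `f`,
traversed with `f` on the left. -/
def IsFacialWalk (f : F) (c : Cycle V) : Prop :=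
  ∃ w : Cycle G.graph.Dart, w ≠ Cycle.nil ∧ w.Nodup ∧
    w.Chain (fun d e => e = G.rot d.symm) ∧ (∀ d ∈ w, G.face d = f) ∧
    c = w.map (fun d => d.fst)

/-- `c` is a perimeter of `P`: a cycle of boundary edges of `P`, i.e. edges having a face
outside `P` on one side and a face in `P` on the other.  It is traversed with the hole on the
left, so that every perimeter occurs with one orientation only. -/
def IsPerimeter (P : Set F) (c : Cycle (G.skeleton P).verts) : Prop :=
  c ≠ Cycle.nil ∧ c.Nodup ∧
    c.Chain (fun u v : (G.skeleton P).verts => ∃ d : G.graph.Dart,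
      d.fst = (u : V) ∧ d.snd = (v : V) ∧ G.face d ∉ P ∧ G.face d.symm ∈ P)

/-- `C 0, …, C (k - 1)` is a labelling of the perimeters of `P`. -/
def IsPerimeterLabelling (P : Set F) {k : ℕ} (C : Fin k → Cycle (G.skeleton P).verts) : Prop :=
  Function.Injective C ∧ Set.range C = {c | G.IsPerimeter P c}

end PlaneCubicGraph

/-- A graph with a collection of faces, each given by its set of oriented boundary walks, and
with labelled oriented cycles (the perimeters of the holes). -/
structure HoledComplex (k : ℕ) where
  Vert : Type u
  graph : SimpleGraph Vert
  faces : Set (Set (Cycle Vert))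
  perimeter : Fin k → Cycle Vert

/-- A set of faces `P` with its labelled perimeters: the skeleton together with the information
which faces are present. -/
def PlaneCubicGraph.complex {V F : Type u} (G : PlaneCubicGraph V F) (P : Set F) {k : ℕ}
    (C : Fin k → Cycle (G.skeleton P).verts) : HoledComplex.{u} k where
  Vert := (G.skeleton P).verts
  graph := (G.skeleton P).coe
  faces := {s | ∃ f ∈ P, s = {c | G.IsFacialWalk f (c.map Subtype.val)}}
  perimeter := C

/-- Replace every entry of a cyclic sequence by a (possibly empty) list of entries. -/
def Cycle.substitute {α β : Type*} (f : α → List β) : Cycle α → Cycle β :=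
  Quotient.map (fun l => l.flatMap f) (by
    rintro l l' ⟨n, rfl⟩
    change l.flatMap f ~r (l.rotate n).flatMap f
    induction n generalizing l with
    | zero => rw [List.rotate_zero]
    | succ n ih =>
      cases l with
      | nil => simp
      | cons a l =>
        rw [List.rotate_cons_succ]
        refine List.IsRotated.trans ?_ (ih (l := l ++ [a]))
        simpa using (List.isRotated_append : f a ++ l.flatMap f ~r l.flatMap f ++ f a))

namespace HoledComplex

variable {k : ℕ}

/-- The complexes agree up to renaming the vertices. -/
def Isomorphic (S T : HoledComplex.{u} k) : Prop :=
  ∃ e : S.graph ≃g T.graph,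
    T.faces = (fun s => Cycle.map e '' s) '' S.faces ∧
    ∀ i, T.perimeter i = (S.perimeter i).map e

/-- The degree-2 vertices on the `j`-th cycle. -/
def deg2 (S : HoledComplex.{u} k) (j : Fin k) : Set S.Vert :=
  {v | v ∈ S.perimeter j ∧ (S.graph.neighborSet v).ncard = 2}

/-- The vertices of the altan at the `j`-th cycle `C`: the old ones, and for each degree-2 vertex
`v` of `C` two new ones, `v' = Sum.inr (v, false)` and `v'' = Sum.inr (v, true)`. -/
abbrev AltanVert (S : HoledComplex.{u} k) (j : Fin k) : Type u :=
  S.Vert ⊕ (S.deg2 j × Bool)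

open Classical in
/-- The new cycle `u₁', u₁'', u₂', u₂'', …`, where `u₁, u₂, …` are the degree-2 vertices of the
`j`-th cycle in their cyclic order. -/
noncomputable def newPerimeter (S : HoledComplex.{u} k) (j : Fin k) : Cycle (S.AltanVert j) :=
  (S.perimeter j).substitute fun v =>
    if h : v ∈ S.deg2 j then [Sum.inr (⟨v, h⟩, false), Sum.inr (⟨v, h⟩, true)] else []

/-- The edges of the altan: the old edges, the spokes, and the edges of the new cycle. -/
inductive AltanEdge (S : HoledComplex.{u} k) (j : Fin k) : S.AltanVert j → S.AltanVert j → Prop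
  | old {u v : S.Vert} : S.graph.Adj u v → AltanEdge S j (Sum.inl u) (Sum.inl v)
  | spoke (v : S.deg2 j) : AltanEdge S j (Sum.inl v) (Sum.inr (v, false))
  | ring {x y : S.AltanVert j} {l : List (S.AltanVert j)} :
      S.newPerimeter j = ((x :: y :: l : List _) : Cycle _) → AltanEdge S j x y

/-- The new faces: if `v` is the next degree-2 vertex after `u` on the `j`-th cycle and `a` is
the sequence of vertices strictly between them, the face bounded by
`u, a, v, v', u'', u'`. -/
def annulusFaces (S : HoledComplex.{u} k) (j : Fin k) : Set (Set (Cycle (S.AltanVert j))) :=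
  {s | ∃ (u v : S.deg2 j) (a b : List S.Vert),
    S.perimeter j = (((u : S.Vert) :: (a ++ (v : S.Vert) :: b) : List _) : Cycle _) ∧
    (∀ x ∈ a, x ∉ S.deg2 j) ∧
    s = {(((Sum.inl (u : S.Vert) :: a.map Sum.inl) ++
      [Sum.inl (v : S.Vert), Sum.inr (v, false), Sum.inr (u, true), Sum.inr (u, false)] :
        List (S.AltanVert j)) : Cycle (S.AltanVert j))}}

open Classical in
/-- The altan with respect to the `j`-th cycle.  Its `j`-th cycle is the new one, the
other cycles and the old faces are kept, and the faces between the old and the new cycle are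
added. -/
noncomputable def altanAt (S : HoledComplex.{u} k) (j : Fin k) : HoledComplex.{u} k where
  Vert := S.AltanVert j
  graph := SimpleGraph.fromRel (S.AltanEdge j)
  faces := (fun s => Cycle.map Sum.inl '' s) '' S.faces ∪ S.annulusFaces j
  perimeter i := if i = j then S.newPerimeter j else (S.perimeter i).map Sum.inl

/-- The generalised altan `A(S; J)`: the altan operation is performed on the cycles with labels
in `J`, smallest label first. -/
noncomputable def altan (S : HoledComplex.{u} k) (J : Finset (Fin k)) : HoledComplex.{u} k :=
  (J.sort (· ≤ ·)).foldl altanAt S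

/-- The generalised iterated altan `A^n(S)`: perform the generalised altan operation on all
cycles with `n i > 0`, decrease these `n i` by one, and continue until `n = 0`. -/
noncomputable def iteratedAltan (n : Fin k → ℕ) (S : HoledComplex.{u} k) : HoledComplex.{u} k :=
  if n = 0 then S
  else iteratedAltan (fun i => n i - 1) (S.altan (Finset.univ.filter fun i => 0 < n i))
termination_by ∑ i, n i
decreasing_by
  rename_i h
  obtain ⟨i, hi⟩ := Function.ne_iff.1 h
  exact Finset.sum_lt_sum (fun i _ => Nat.sub_le _ _)
    ⟨i, Finset.mem_univ i, Nat.sub_lt (Nat.pos_of_ne_zero hi) one_pos⟩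

/-- `S` is a perforated patch of some finite plane cubic graph, with all its perimeters. -/
def IsPerforatedPatch (S : HoledComplex.{u} k) : Prop :=
  ∃ (V F : Type u) (G : PlaneCubicGraph V F) (P : Set F)
    (C : Fin k → Cycle (G.skeleton P).verts),
    G.IsPerforatedPatch P ∧ G.IsPerimeterLabelling P C ∧ (G.complex P C).Isomorphic S

/-- `S` is a patch of some finite plane cubic graph, with its perimeter. -/
def IsPatch (S : HoledComplex.{u} k) : Prop :=
  ∃ (V F : Type u) (G : PlaneCubicGraph V F) (P : Set F)
    (C : Fin k → Cycle (G.skeleton P).verts),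
    G.IsPatch P ∧ G.IsPerimeterLabelling P C ∧ (G.complex P C).Isomorphic S

end HoledComplex

/-- 2-connected: at least three vertices, connected, and still connected after the removal of
any one vertex. -/
def SimpleGraph.TwoConnected {V : Type*} (H : SimpleGraph V) : Prop :=
  3 ≤ Nat.card V ∧ H.Connected ∧ ∀ v : V, (H.induce {v}ᶜ).Connected

/-! The altan can be drawn on the sphere that carries the graph. At a degree-2 vertex u of a
perimeter the third edge t(u) runs into the hole. Draw the ring u₁'u₁''u₂'u₂''… in the hole, close
to the perimeter, cut every t(u) near u, end the inner piece at u' (this is the spoke) and let the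
outer piece start at u''. If t(u) = t(w) reversed, the outer piece joins u'' to w''. The result is
cubic; it is simple because there are at least two degree-2 vertices. No old face disappears: the
ring only splits off a strip along the perimeter, which is cut by the spokes into d new faces. So
there are 2d more vertices, d more faces and the same number of components, and Euler's formula,
written as 2|F| = |V| + 2 + 2c by means of 2|E| = 3|V|, persists. This surgery is
`CubicMap.AnnulusData.altan`, carried out on darts; `CubicMap.PerimeterData.annulusData` supplies
its input from a perimeter.

Let P' consist of P and the new faces. Each new face shares a perimeter edge with P, so P' is
connected. The faces outside P' are those outside P, and they still meet across the outer pieces of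
the t(u), so a connected complement stays connected. The outer pieces have no face of P' beside
them; hence the skeleton, faces and perimeters of P' are exactly those of the altan
(`CubicMap.PerimeterData.realizes_altanAt`).

The steps do not interfere. In a cubic map at most one boundary dart leaves a vertex, so distinct
perimeters are disjoint; an altan at one of them does not change degrees on the others, and the
vertices u'' have degree 2 on the new cycle. For 2-connectedness, after the deletion of any vertex
every remaining ring vertex still reaches a remaining old vertex
(`HoledComplex.Segments.twoConnected_altanGraph`). The invariant `HoledComplex.Admissible` carries
all of this through the iteration. -/

/-! ### Lists: rotations, chains of functional relations, blocks. -/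

theorem List.eq_of_cons_isRotated_cons {α : Type*} {x : α} {l l' : List α}
    (h : (x :: l) ~r (x :: l')) (hn : (x :: l).Nodup) : l = l' := by
  obtain ⟨n, hn'⟩ := h
  have h0 : ((x :: l).rotate n)[0]'(by simp) = x := by simp [hn']
  rw [List.getElem_rotate] at h0
  have h1 : (0 + n) % (x :: l).length = 0 := by
    have := (List.Nodup.getElem_inj_iff hn (i := (0 + n) % (x :: l).length) (j := 0)
      (hi := Nat.mod_lt _ (by simp)) (hj := by simp)).1 (by simpa using h0)
    exact this
  rw [Nat.zero_add] at h1
  rw [← List.rotate_mod, h1, List.rotate_zero] at hn'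
  exact (List.cons.inj hn').2

/-- Both decompositions cut at the first entry with property `p`. With `p` being "of degree 2" this
pins down the segment of a perimeter that borders a new face. -/
theorem List.append_cons_inj_of_first {α : Type*} {p : α → Prop} {a a' b b' : List α} {v v' : α}
    (h : a ++ v :: b = a' ++ v' :: b') (ha : ∀ x ∈ a, ¬ p x) (ha' : ∀ x ∈ a', ¬ p x)
    (hv : p v) (hv' : p v') : a = a' ∧ v = v' ∧ b = b' := by
  induction a generalizing a' with
  | nil =>
    cases a' with
    | nil => simpa using h
    | cons y a' =>
      simp only [List.nil_append, List.cons_append, List.cons.injEq] at h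
      exact absurd (h.1 ▸ hv) (ha' y (by simp))
  | cons y a ih =>
    cases a' with
    | nil =>
      simp only [List.nil_append, List.cons_append, List.cons.injEq] at h
      exact absurd (h.1 ▸ hv') (ha y (by simp))
    | cons z a' =>
      simp only [List.cons_append, List.cons.injEq] at h
      obtain ⟨h1, h2, h3⟩ := ih h.2 (fun x hx => ha x (by simp [hx]))
        (fun x hx => ha' x (by simp [hx]))
      exact ⟨by rw [h.1, h1], h2, h3⟩

/-- Two chains of a functional relation with the same start and the same end point, that avoid the
end point in between, agree. -/
theorem List.eq_of_isChain_functional {α : Type*} {r : α → α → Prop}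
    (hr : ∀ a b c, r a b → r a c → b = c) {v : α} {x : α} {l l' : List α}
    (h : List.IsChain r (x :: (l ++ [v]))) (h' : List.IsChain r (x :: (l' ++ [v])))
    (hl : v ∉ l) (hl' : v ∉ l') : l = l' := by
  induction l generalizing l' x with
  | nil =>
    cases l' with
    | nil => rfl
    | cons y l' =>
      simp only [List.nil_append, List.cons_append, List.isChain_cons_cons] at h h'
      exact absurd (hr _ _ _ h.1 h'.1) (by rintro rfl; simp at hl')
  | cons y l ih =>
    cases l' with
    | nil =>
      simp only [List.nil_append, List.cons_append, List.isChain_cons_cons] at h h'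
      exact absurd (hr _ _ _ h'.1 h.1) (by rintro rfl; simp at hl)
    | cons z l' =>
      simp only [List.cons_append, List.isChain_cons_cons] at h h'
      obtain rfl := hr _ _ _ h.1 h'.1
      rw [ih h.2 h'.2 (by simp_all) (by simp_all)]

/-- In a chain of a functional relation, successors of the members other than the last are
members. -/
theorem List.mem_tail_of_isChain_functional {α : Type*} {r : α → α → Prop}
    (hr : ∀ a b c, r a b → r a c → b = c) {v x : α} {l : List α}
    (h : List.IsChain r (x :: (l ++ [v]))) {y z : α} (hy : y ∈ x :: l) (hyz : r y z) :
    z ∈ l ∨ z = v := by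
  induction l generalizing x with
  | nil =>
    simp only [List.nil_append, List.isChain_cons_cons] at h
    obtain rfl : y = x := by simpa using hy
    exact Or.inr (hr _ _ _ hyz h.1)
  | cons w l ih =>
    simp only [List.cons_append, List.isChain_cons_cons] at h
    rcases List.mem_cons.1 hy with rfl | hy
    · exact Or.inl (by simp [hr _ _ _ hyz h.1])
    · rcases ih h.2 hy with h | h
      · exact Or.inl (by simp [h])
      · exact Or.inr h

theorem List.exists_flatMap_blocks {α : Type*} (p : α → Prop) (l : List α)
    (hl : ∀ x, l.head? = some x → p x) : ∃ L : List (α × List α),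
      l = L.flatMap (fun B => B.1 :: B.2) ∧ ∀ B ∈ L, p B.1 ∧ ∀ x ∈ B.2, ¬ p x := by
  -- Allowing a prefix without `p` makes the induction go through: the prefix of the tail becomes
  -- the body of a block as soon as an entry with `p` is put in front of it.
  suffices H : ∀ l : List α, ∃ (a : List α) (L : List (α × List α)),
      l = a ++ L.flatMap (fun B => B.1 :: B.2) ∧ (∀ x ∈ a, ¬ p x) ∧
        ∀ B ∈ L, p B.1 ∧ ∀ x ∈ B.2, ¬ p x by
    obtain ⟨a, L, h1, h2, h3⟩ := H l
    cases a with
    | nil => exact ⟨L, by simpa using h1, h3⟩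
    | cons x a => exact absurd (hl x (by simp [h1])) (h2 x (by simp))
  intro l
  induction l with
  | nil => exact ⟨[], [], by simp⟩
  | cons x l ih =>
    obtain ⟨a, L, h1, h2, h3⟩ := ih
    by_cases hx : p x
    · refine ⟨[], (x, a) :: L, by simp [h1], by simp, ?_⟩
      intro B hB
      rcases List.mem_cons.1 hB with rfl | hB
      · exact ⟨hx, h2⟩
      · exact h3 B hB
    · refine ⟨x :: a, L, by simp [h1], ?_, h3⟩
      intro y hy
      rcases List.mem_cons.1 hy with rfl | hy
      · exact hx
      · exact h2 y hy

theorem List.exists_map_eq {α β : Type*} {f : α → β} {l : List β}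
    (h : ∀ x ∈ l, x ∈ Set.range f) : ∃ l', List.map f l' = l := by
  induction l with
  | nil => exact ⟨[], rfl⟩
  | cons x l ih =>
    obtain ⟨l', rfl⟩ := ih (fun y hy => h y (List.mem_cons_of_mem _ hy))
    obtain ⟨y, rfl⟩ := h x List.mem_cons_self
    exact ⟨y :: l', rfl⟩

/-! ### Cyclic sequences. -/

namespace Cycle

variable {α β : Type*}

theorem exists_eq_coe_cons {c : Cycle α} {x : α} (hx : x ∈ c) : ∃ l : List α,
    c = ((x :: l : List α) : Cycle α) := by
  induction c using Quotient.inductionOn with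
  | _ l =>
    obtain ⟨a, b, rfl⟩ := List.append_of_mem (show x ∈ l from hx)
    exact ⟨b ++ a, Cycle.coe_eq_coe.2 (by simpa using List.isRotated_append (l := a) (l' := x :: b))⟩

theorem exists_mem_of_ne_nil {c : Cycle α} (hc : c ≠ Cycle.nil) : ∃ x, x ∈ c := by
  induction c using Quotient.inductionOn with
  | _ l =>
    cases l with
    | nil => exact absurd rfl hc
    | cons x l => exact ⟨x, List.mem_cons_self⟩

theorem coe_cons_inj {x : α} {l l' : List α} (hn : (x :: l).Nodup)
    (h : ((x :: l : List α) : Cycle α) = ((x :: l' : List α) : Cycle α)) : l = l' :=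
  List.eq_of_cons_isRotated_cons (Cycle.coe_eq_coe.1 h) hn

/-- Cut both cycles open at the common entry; from there the successors are forced until the entry
returns. This gives uniqueness both of facial walks (orbits of a map on darts) and of perimeters
(orbits of a partial map on vertices). -/
theorem eq_of_functional {r : α → α → Prop} (hr : ∀ a b c, r a b → r a c → b = c)
    {c c' : Cycle α} (hn : c.Nodup) (hn' : c'.Nodup) (hc : c.Chain r) (hc' : c'.Chain r)
    {x : α} (hx : x ∈ c) (hx' : x ∈ c') : c = c' := by
  obtain ⟨l, rfl⟩ := exists_eq_coe_cons hx
  obtain ⟨l', rfl⟩ := exists_eq_coe_cons hx'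
  rw [Cycle.nodup_coe_iff, List.nodup_cons] at hn hn'
  rw [Cycle.chain_coe_cons] at hc hc'
  rw [List.eq_of_isChain_functional hr hc hc' hn.1 hn'.1]

theorem map_map {γ : Type*} (f : α → β) (g : β → γ) (c : Cycle α) :
    (c.map f).map g = c.map (g ∘ f) := by
  induction c using Quotient.inductionOn with
  | _ l => exact congrArg Cycle.ofList (List.map_map (f := f) (g := g) (l := l))

theorem map_injective {f : α → β} (hf : Function.Injective f) :
    Function.Injective (Cycle.map f) := by
  intro c c' h
  induction c using Quotient.inductionOn with
  | _ l =>
  induction c' using Quotient.inductionOn with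
  | _ l' =>
    have h' : (l.map f) ~r (l'.map f) := Cycle.coe_eq_coe.1 h
    obtain ⟨n, hn⟩ := h'
    rw [← List.map_rotate] at hn
    exact Cycle.coe_eq_coe.2 ⟨n, List.map_injective_iff.2 hf hn⟩

theorem nodup_map_iff {f : α → β} (hf : Function.Injective f) {c : Cycle α} :
    (c.map f).Nodup ↔ c.Nodup := by
  induction c using Quotient.inductionOn with
  | _ l => exact List.nodup_map_iff hf

theorem Nodup.of_map {f : α → β} {c : Cycle α} (h : (c.map f).Nodup) : c.Nodup := by
  induction c using Quotient.inductionOn with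
  | _ l => exact List.Nodup.of_map f h

theorem exists_map_eq_of_forall_mem_range {f : α → β} {c : Cycle β}
    (h : ∀ x ∈ c, x ∈ Set.range f) : ∃ c' : Cycle α, c'.map f = c := by
  induction c using Quotient.inductionOn with
  | _ l =>
    obtain ⟨l', rfl⟩ := List.exists_map_eq (l := l) h
    exact ⟨(l' : Cycle α), rfl⟩

theorem Chain.imp_of_mem {r s : α → α → Prop} {c : Cycle α} (h : c.Chain r)
    (hrs : ∀ a ∈ c, ∀ b ∈ c, r a b → s a b) : c.Chain s := by
  induction c using Quotient.inductionOn with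
  | _ l =>
    cases l with
    | nil => trivial
    | cons x l =>
      change Cycle.Chain r ((x :: l : List α) : Cycle α) at h
      change Cycle.Chain s ((x :: l : List α) : Cycle α)
      rw [Cycle.chain_coe_cons] at h ⊢
      refine h.imp_of_mem_imp fun a b ha hb => hrs a ?_ b ?_
      · change a ∈ x :: l
        simp only [List.mem_cons, List.mem_append, List.not_mem_nil, or_false] at ha ⊢
        tauto
      · change b ∈ x :: l
        simp only [List.mem_cons, List.mem_append, List.not_mem_nil, or_false] at hb ⊢
        tauto

/-- A set that is closed under successors and contains a member contains all members. -/
theorem Chain.forall_mem {r : α → α → Prop} {c : Cycle α} (h : c.Chain r) {p : α → Prop}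
    (hp : ∀ a b, a ∈ c → b ∈ c → r a b → p a → p b) {x : α} (hx : x ∈ c) (hpx : p x) :
    ∀ y ∈ c, p y := by
  obtain ⟨l, rfl⟩ := exists_eq_coe_cons hx
  rw [Cycle.chain_coe_cons] at h
  have key : ∀ (l' : List α) (x' : α), x' ∈ x :: l → (∀ y ∈ l', y ∈ x :: l) → p x' →
      List.IsChain r (x' :: l') → ∀ y ∈ l', p y := by
    intro l'
    induction l' with
    | nil => simp
    | cons z l' ih =>
      intro x' hx' hl' hpx' hc y hy
      rw [List.isChain_cons_cons] at hc
      have hz : p z := hp x' z hx' (hl' z (by simp)) hc.1 hpx'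
      rcases List.mem_cons.1 hy with rfl | hy
      · exact hz
      · exact ih z (hl' z (by simp)) (fun y hy => hl' y (by simp [hy])) hz hc.2 y hy
  intro y hy
  have hy' : y ∈ x :: l := hy
  refine key (l ++ [x]) x (by simp) (fun z hz => ?_) hpx h y ?_
  · simp only [List.mem_cons, List.mem_append, List.not_mem_nil, or_false] at hz ⊢
    tauto
  · simp only [List.mem_cons, List.mem_append, List.not_mem_nil, or_false] at hy' ⊢
    tauto

theorem exists_rel_of_chain {r : α → α → Prop} {c : Cycle α} (h : c.Chain r) {x : α}
    (hx : x ∈ c) : ∃ y ∈ c, r x y := by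
  obtain ⟨l, rfl⟩ := exists_eq_coe_cons hx
  rw [Cycle.chain_coe_cons] at h
  cases l with
  | nil =>
    simp only [List.nil_append, List.isChain_cons_cons] at h
    exact ⟨x, hx, h.1⟩
  | cons y l =>
    simp only [List.cons_append, List.isChain_cons_cons] at h
    exact ⟨y, by simp, h.1⟩

theorem exists_rel_of_chain' {r : α → α → Prop} {c : Cycle α} (h : c.Chain r) {x : α}
    (hx : x ∈ c) : ∃ y ∈ c, r y x := by
  obtain ⟨l, rfl⟩ := exists_eq_coe_cons hx
  rw [Cycle.chain_coe_cons] at h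
  rcases List.eq_nil_or_concat l with rfl | ⟨l, y, rfl⟩
  · simp only [List.nil_append, List.isChain_cons_cons] at h
    exact ⟨x, hx, h.1⟩
  · refine ⟨y, by simp, ?_⟩
    have : List.IsChain r ((x :: l) ++ ([y] ++ [x])) := by simpa using h
    have := (List.isChain_append.1 this).2.1
    simpa using this

end Cycle

/-! ### Cubic maps with abstract darts, and their boundary darts. -/

/-- The combinatorial data of a plane cubic simple graph with an abstract type of darts: the
reversal `inv`, the rotation `rot` at the tail, and the face on the left.  Euler's formula is
expressed through the relation `2 |E| = 3 |V|`. -/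
structure CubicMap (V F D : Type u) where
  finite_vert : Finite V
  inv : D → D
  inv_inv : ∀ d, inv (inv d) = d
  rot : D → D
  tail : D → V
  face : D → F
  tail_inj : ∀ d e, tail d = tail e → tail (inv d) = tail (inv e) → d = e
  tail_inv_ne : ∀ d, tail (inv d) ≠ tail d
  rot_rot_rot : ∀ d, rot (rot (rot d)) = d
  rot_ne : ∀ d, rot d ≠ d
  tail_rot : ∀ d, tail (rot d) = tail d
  eq_of_tail_eq : ∀ d e, tail d = tail e → e = d ∨ e = rot d ∨ e = rot (rot d)
  tail_surj : ∀ v, ∃ d, tail d = v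
  face_surj : ∀ f, ∃ d, face d = f
  face_rot_inv : ∀ d, face (rot (inv d)) = face d
  dual_conn : ∀ a b, Relation.ReflTransGen (fun a b => ∃ d, face d = a ∧ face (inv d) = b) a b
  euler : 2 * Nat.card F = Nat.card V + 2 +
    2 * Nat.card (Quot fun u v => ∃ d, tail d = u ∧ tail (inv d) = v)

namespace CubicMap

variable {V F D : Type u} (M : CubicMap V F D) (P : Set F)

/-- A non-empty set of faces any two members of which are joined within the set. -/
def DualConnected (Q : Set F) : Prop :=
  Q.Nonempty ∧ ∀ a ∈ Q, ∀ b ∈ Q, Relation.ReflTransGen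
    (fun a b => a ∈ Q ∧ b ∈ Q ∧ ∃ d, M.face d = a ∧ M.face (M.inv d) = b) a b

/-- A proper connected set of faces. -/
def IsPerforatedPatch : Prop := P ≠ Set.univ ∧ M.DualConnected P

/-- The cyclic sequences of vertices on the boundary walks of a face. -/
def IsFacialWalk (f : F) (c : Cycle V) : Prop :=
  ∃ w : Cycle D, w ≠ Cycle.nil ∧ w.Nodup ∧ w.Chain (fun d e => e = M.rot (M.inv d)) ∧
    (∀ d ∈ w, M.face d = f) ∧ c = w.map M.tail

/-- A dart with a face outside `P` on its left and a face in `P` on its right. -/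
def IsBoundary (d : D) : Prop := M.face d ∉ P ∧ M.face (M.inv d) ∈ P

/-- Two vertices that are joined by a boundary dart. -/
def BoundaryRel (u v : V) : Prop := ∃ d, M.tail d = u ∧ M.tail (M.inv d) = v ∧ M.IsBoundary P d

/-- The directed cycles of boundary darts. -/
def IsPerimeter (c : Cycle V) : Prop :=
  c ≠ Cycle.nil ∧ c.Nodup ∧ c.Chain (M.BoundaryRel P)

theorem face_rot (d : D) : M.face (M.rot d) = M.face (M.inv d) := by
  have := M.face_rot_inv (M.inv d)
  rwa [M.inv_inv] at this

theorem inv_injective : Function.Injective M.inv :=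
  Function.LeftInverse.injective M.inv_inv

theorem rot_rot_ne (d : D) : M.rot (M.rot d) ≠ d := by
  intro h
  have := M.rot_rot_rot d
  rw [h] at this
  exact M.rot_ne d this

theorem inv_ne (d : D) : M.inv d ≠ d := fun h => M.tail_inv_ne d (by rw [h])

variable {M P}

/-- The face on the right of `d` is the face on the left of `rot d`, so a boundary dart marks a
passage from outside `P` into `P` among the three sectors at its tail. A cyclic sequence of three
sectors has at most one such passage. -/
theorem IsBoundary.eq_of_tail_eq {d e : D} (hd : M.IsBoundary P d) (he : M.IsBoundary P e)
    (h : M.tail d = M.tail e) : d = e := by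
  rcases M.eq_of_tail_eq d e h with rfl | rfl | rfl
  · rfl
  · exact absurd hd.2 (M.face_rot d ▸ he.1)
  · have h1 := he.2
    rw [← M.face_rot, M.rot_rot_rot] at h1
    exact absurd h1 hd.1

theorem BoundaryRel.functional (a b c : V) (h : M.BoundaryRel P a b) (h' : M.BoundaryRel P a c) :
    b = c := by
  obtain ⟨d, hd, rfl, hb⟩ := h
  obtain ⟨e, he, rfl, hb'⟩ := h'
  rw [hb.eq_of_tail_eq hb' (hd.trans he.symm)]

/-- Distinct perimeters are therefore disjoint, which is why altans at different cycles do not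
interfere. -/
theorem IsPerimeter.eq_of_mem {c c' : Cycle V} (h : M.IsPerimeter P c) (h' : M.IsPerimeter P c')
    {x : V} (hx : x ∈ c) (hx' : x ∈ c') : c = c' :=
  Cycle.eq_of_functional BoundaryRel.functional h.2.1 h'.2.1 h.2.2 h'.2.2 hx hx'

/-! ### Insertion of a ring: the surgery on darts. -/

variable (M P)

/-- The data needed to insert a ring into a hole of `P`: `t u` is the dart that leaves the
perimeter at the degree-2 vertex with label `u` into the hole, `N u` is the label of the next
degree-2 vertex, and `lab` marks the darts on the old part of the boundary of the new faces. -/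
structure AnnulusData (U : Type u) where
  N : Equiv.Perm U
  N_ne : ∀ u, N u ≠ u
  t : U → D
  tail_t_inj : ∀ u v, M.tail (t u) = M.tail (t v) → u = v
  lab : D → Option U
  lab_t : ∀ u, lab (t (N u)) = some u
  lab_rot_t : ∀ u, lab (M.rot (t u)) = some u
  face_not_mem : ∀ d u, lab d = some u → M.face d ∉ P
  boundary_or : ∀ d u, lab d = some u → M.face (M.inv d) ∈ P ∨ ∃ v, d = t v
  face_inv_t : ∀ u, M.face (M.inv (t u)) ∉ P
  face_inv_rot_t : ∀ u, M.face (M.inv (M.rot (t u))) ∈ P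
  face_eq : ∀ d u, lab d = some u → M.face d = M.face (t (N u))
  lab_rot_inv : ∀ d, (∀ u, d ≠ t u) → (∀ u, M.inv d ≠ t u) → lab (M.rot (M.inv d)) = lab d
  lab_rot_inv_t : ∀ u, (∀ w, M.inv (t u) ≠ t w) → lab (M.rot (M.inv (t u))) = none
  conn : ∀ u, Quot.mk (fun u v => ∃ d, M.tail d = u ∧ M.tail (M.inv d) = v) (M.tail (t u)) =
    Quot.mk _ (M.tail (t (N u)))

/-- The darts after the insertion of a ring. -/
inductive AltanDart (D U : Type u) : Type u
  | old (d : D)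
  | s (u : U)
  | q (u : U)
  | p (u : U)
  | o (u : U)
  | n (u : U)
  | m (u : U)

namespace AnnulusData

open AltanDart

variable {M P} {U : Type u} (A : M.AnnulusData P U)

end AnnulusData
end CubicMap

namespace CubicMap

variable {V F D : Type u} {M : CubicMap V F D} {P : Set F}
namespace AnnulusData
open AltanDart

variable {U : Type u} (A : M.AnnulusData P U)

theorem t_injective {u v : U} (h : A.t u = A.t v) : u = v := A.tail_t_inj u v (by rw [h])

theorem face_t_not_mem (u : U) : M.face (A.t u) ∉ P := by
  have := A.face_not_mem _ _ (A.lab_t (A.N.symm u))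
  rwa [A.N.apply_symm_apply] at this

theorem lab_t' (u : U) : A.lab (A.t u) = some (A.N.symm u) := by
  have := A.lab_t (A.N.symm u)
  rwa [A.N.apply_symm_apply] at this

theorem lab_eq_none_of_mem {d : D} (h : M.face d ∈ P) : A.lab d = none := by
  rcases hd : A.lab d with - | u
  · rfl
  · exact absurd h (A.face_not_mem d u hd)

theorem lab_eq_none {d : D} (h : M.face (M.inv d) ∉ P) (ht : ∀ u, d ≠ A.t u) :
    A.lab d = none := by
  rcases hd : A.lab d with - | u
  · rfl
  · rcases A.boundary_or d u hd with h' | ⟨v, rfl⟩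
    · exact absurd h' h
    · exact absurd rfl (ht v)

theorem lab_inv_t_eq_none {u : U} (ht : ∀ w, M.inv (A.t u) ≠ A.t w) :
    A.lab (M.inv (A.t u)) = none :=
  A.lab_eq_none (by rw [M.inv_inv]; exact A.face_t_not_mem u) ht

theorem face_rot_t (u : U) : M.face (M.rot (A.t u)) = M.face (A.t (A.N u)) :=
  A.face_eq _ _ (A.lab_rot_t u)

open Classical in
/-- The reversal of the darts after the insertion of the ring. -/
noncomputable def inv' : AltanDart D U → AltanDart D U
  | old d => if h : ∃ u, d = A.t u then s h.choose else
      if h : ∃ u, M.inv d = A.t u then o h.choose else old (M.inv d)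
  | s u => old (A.t u)
  | q u => n (A.N.symm u)
  | p u => m u
  | o u => if h : ∃ w, M.inv (A.t u) = A.t w then o h.choose else old (M.inv (A.t u))
  | n u => q (A.N u)
  | m u => p u

theorem inv'_t (u : U) : A.inv' (old (A.t u)) = s u := by
  have h : ∃ v, A.t u = A.t v := ⟨u, rfl⟩
  rw [inv', dif_pos h, ← A.t_injective h.choose_spec]

theorem inv'_inv_t {d : D} {u : U} (hd : ∀ w, d ≠ A.t w) (h : M.inv d = A.t u) :
    A.inv' (old d) = o u := by
  have h' : ∃ v, M.inv d = A.t v := ⟨u, h⟩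
  rw [inv', dif_neg (by simpa using hd), dif_pos h', ← A.t_injective (h.symm.trans h'.choose_spec)]

theorem inv'_old {d : D} (hd : ∀ w, d ≠ A.t w) (h : ∀ w, M.inv d ≠ A.t w) :
    A.inv' (old d) = old (M.inv d) := by
  rw [inv', dif_neg (by simpa using hd), dif_neg (by simpa using h)]

theorem inv'_o_t {u w : U} (h : M.inv (A.t u) = A.t w) : A.inv' (o u) = o w := by
  have h' : ∃ v, M.inv (A.t u) = A.t v := ⟨w, h⟩
  rw [inv', dif_pos h', ← A.t_injective (h.symm.trans h'.choose_spec)]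

theorem inv'_o {u : U} (h : ∀ w, M.inv (A.t u) ≠ A.t w) :
    A.inv' (o u) = old (M.inv (A.t u)) := by
  rw [inv', dif_neg (by simpa using h)]

/-- The rotation of the darts after the insertion of the ring. -/
def rot' (_ : M.AnnulusData P U) : AltanDart D U → AltanDart D U
  | old d => old (M.rot d)
  | s u => q u
  | q u => p u
  | p u => s u
  | o u => n u
  | n u => m u
  | m u => o u

/-- The tails of the darts after the insertion of the ring. -/
def tail' (_ : M.AnnulusData P U) : AltanDart D U → V ⊕ (U × Bool)
  | old d => Sum.inl (M.tail d)
  | s u => Sum.inr (u, false)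
  | q u => Sum.inr (u, false)
  | p u => Sum.inr (u, false)
  | o u => Sum.inr (u, true)
  | n u => Sum.inr (u, true)
  | m u => Sum.inr (u, true)

/-- The faces after the insertion of the ring. -/
def face' : AltanDart D U → F ⊕ U
  | old d => (A.lab d).elim (Sum.inl (M.face d)) Sum.inr
  | s u => Sum.inr u
  | q u => Sum.inr (A.N.symm u)
  | p u => Sum.inl (M.face (A.t u))
  | o u => Sum.inl (M.face (A.t u))
  | n u => Sum.inl (M.face (M.rot (A.t u)))
  | m u => Sum.inr u

theorem face'_old {d : D} (h : A.lab d = none) : A.face' (old d) = Sum.inl (M.face d) := by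
  simp [face', h]

theorem face'_old_some {d : D} {u : U} (h : A.lab d = some u) : A.face' (old d) = Sum.inr u := by
  simp [face', h]

/-- The old darts come in three kinds. -/
theorem dart_cases (d : D) : (∃ u, d = A.t u) ∨
    (∃ u, (∀ w, d ≠ A.t w) ∧ d = M.inv (A.t u)) ∨
      ((∀ w, d ≠ A.t w) ∧ ∀ w, M.inv d ≠ A.t w) := by
  by_cases h : ∃ u, d = A.t u
  · exact Or.inl h
  · by_cases h' : ∃ u, M.inv d = A.t u
    · obtain ⟨u, hu⟩ := h'
      exact Or.inr (Or.inl ⟨u, by simpa using h, by rw [← hu, M.inv_inv]⟩)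
    · exact Or.inr (Or.inr ⟨by simpa using h, by simpa using h'⟩)

theorem inv'_inv' (x : AltanDart D U) : A.inv' (A.inv' x) = x := by
  cases x with
  | old d =>
    rcases A.dart_cases d with ⟨u, rfl⟩ | ⟨u, h, rfl⟩ | ⟨h, h'⟩
    · rw [A.inv'_t]; rfl
    · rw [A.inv'_inv_t h (M.inv_inv _), A.inv'_o h]
    · rw [A.inv'_old h h', A.inv'_old h' (by simpa [M.inv_inv] using h), M.inv_inv]
  | s u => exact A.inv'_t u
  | q u => simp [inv']
  | p u => rfl
  | o u =>
    by_cases h : ∃ w, M.inv (A.t u) = A.t w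
    · obtain ⟨w, hw⟩ := h
      rw [A.inv'_o_t hw, A.inv'_o_t (show M.inv (A.t w) = A.t u by rw [← hw, M.inv_inv])]
    · have h : ∀ w, M.inv (A.t u) ≠ A.t w := by simpa using h
      rw [A.inv'_o h, A.inv'_inv_t h (M.inv_inv _)]
  | n u => simp [inv']
  | m u => rfl

theorem tail'_inv'_t (u : U) : A.tail' (A.inv' (old (A.t u))) = Sum.inr (u, false) := by
  rw [A.inv'_t]; rfl

/-- This is the absence of parallel edges. Old edges cause none, since the head of a cut dart
reveals which `t u` it came from. In the ring, u' and u'' would be joined twice if `N u = u`;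
`N_ne`, and with it the assumption of two degree-2 vertices, excludes this. -/
theorem tail'_inj (x y : AltanDart D U) (h : A.tail' x = A.tail' y)
    (h' : A.tail' (A.inv' x) = A.tail' (A.inv' y)) : x = y := by
  have key : ∀ u, A.N.symm u ≠ u := fun u hu => A.N_ne u (by
    conv_lhs => rw [← hu, A.N.apply_symm_apply])
  have hold : ∀ d u, A.tail' (A.inv' (old d)) = Sum.inr (u, false) → d = A.t u := by
    intro d u hd
    rcases A.dart_cases d with ⟨v, rfl⟩ | ⟨v, h, rfl⟩ | ⟨h, h'⟩
    · rw [A.inv'_t] at hd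
      simp [tail'] at hd
      rw [hd]
    · rw [A.inv'_inv_t h (M.inv_inv _)] at hd
      simp [tail'] at hd
    · rw [A.inv'_old h h'] at hd
      simp [tail'] at hd
  have hold' : ∀ d u, A.tail' (A.inv' (old d)) = Sum.inr (u, true) → M.inv d = A.t u := by
    intro d u hd
    rcases A.dart_cases d with ⟨v, rfl⟩ | ⟨v, h, rfl⟩ | ⟨h, h'⟩
    · rw [A.inv'_t] at hd
      simp [tail'] at hd
    · rw [A.inv'_inv_t h (M.inv_inv _)] at hd
      simp [tail'] at hd
      rw [hd, M.inv_inv]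
    · rw [A.inv'_old h h'] at hd
      simp [tail'] at hd
  have ho : ∀ u v, A.tail' (A.inv' (o u)) ≠ Sum.inr (v, false) := by
    intro u v
    by_cases h : ∃ w, M.inv (A.t u) = A.t w
    · obtain ⟨w, hw⟩ := h
      simp [A.inv'_o_t hw, tail']
    · simp [A.inv'_o (by simpa using h), tail']
  cases x with
  | old d =>
    cases y with
    | old e =>
      have htail : M.tail d = M.tail e := by simpa [tail'] using h
      rcases hz : A.tail' (A.inv' (old d)) with v | ⟨u, b | b⟩
      · have hz' := h'.symm.trans hz
        have aux : ∀ d, A.tail' (A.inv' (old d)) = Sum.inl v → M.tail (M.inv d) = v := by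
          intro d hz
          rcases A.dart_cases d with ⟨v, rfl⟩ | ⟨v, h, rfl⟩ | ⟨h, h'⟩
          · rw [A.inv'_t] at hz
            simp [tail'] at hz
          · rw [A.inv'_inv_t h (M.inv_inv _)] at hz
            simp [tail'] at hz
          · rw [A.inv'_old h h'] at hz
            simpa [tail'] using hz
        rw [M.tail_inj d e htail ((aux d hz).trans (aux e hz').symm)]
      · rw [hold d u hz, hold e u (h'.symm.trans hz)]
      · rw [M.inv_injective ((hold' d u hz).trans (hold' e u (h'.symm.trans hz)).symm)]
    | _ => simp [tail'] at h
  | o u =>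
    cases y with
    | o v => simp [tail'] at h; rw [h]
    | n v => exact absurd h' (ho u _)
    | m v => exact absurd h' (ho u _)
    | _ => simp [tail'] at h
  | n u =>
    cases y with
    | o v => exact absurd h'.symm (ho v _)
    | n v => simp [tail'] at h; rw [h]
    | m v =>
      simp [tail'] at h; subst h
      simp [tail', inv'] at h'
      exact absurd h' (A.N_ne u)
    | _ => simp [tail'] at h
  | m u =>
    cases y with
    | o v => exact absurd h'.symm (ho v _)
    | m v => simp [tail'] at h; rw [h]
    | n v =>
      simp [tail'] at h; subst h
      simp [tail', inv'] at h'
      exact absurd h'.symm (A.N_ne u)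
    | _ => simp [tail'] at h
  | s u =>
    cases y with
    | s v => simp [tail'] at h; rw [h]
    | q v => simp [tail', inv'] at h'
    | p v => simp [tail', inv'] at h'
    | _ => simp [tail'] at h
  | q u =>
    cases y with
    | s v => simp [tail', inv'] at h'
    | q v => simp [tail'] at h; rw [h]
    | p v =>
      simp [tail'] at h; subst h
      simp [tail', inv'] at h'
      exact absurd h' (key u)
    | _ => simp [tail'] at h
  | p u =>
    cases y with
    | s v => simp [tail', inv'] at h'
    | p v => simp [tail'] at h; rw [h]
    | q v =>
      simp [tail'] at h; subst h
      simp [tail', inv'] at h'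
      exact absurd h'.symm (key u)
    | _ => simp [tail'] at h

theorem tail'_inv'_ne (x : AltanDart D U) : A.tail' (A.inv' x) ≠ A.tail' x := by
  cases x with
  | old d =>
    rcases A.dart_cases d with ⟨v, rfl⟩ | ⟨v, h, rfl⟩ | ⟨h, h'⟩
    · rw [A.inv'_t]; simp [tail']
    · rw [A.inv'_inv_t h (M.inv_inv _)]; simp [tail']
    · rw [A.inv'_old h h']; simpa [tail'] using M.tail_inv_ne d
  | o u =>
    by_cases h : ∃ w, M.inv (A.t u) = A.t w
    · obtain ⟨w, hw⟩ := h
      rw [A.inv'_o_t hw]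
      simp only [tail', ne_eq, Sum.inr.injEq, Prod.mk.injEq, and_true]
      rintro rfl
      -- When both ends of a hole edge are cut, its middle piece joins u'' to w''; it is no loop
      -- because no dart is its own reverse.
      exact M.inv_ne _ hw
    · simp [A.inv'_o (by simpa using h), tail']
  | _ => simp [tail', inv']

/-- Facial walks change only at the cut edges. A walk that arrives by `t u` turns at u' into the
ring and closes up a new face; one that comes back along the outer piece of `t u` reaches u'' and
goes on along the outer side of the ring, inside the old hole face. Everywhere else the label is
constant along the old walk. -/
theorem face'_rot'_inv' (x : AltanDart D U) : A.face' (A.rot' (A.inv' x)) = A.face' x := by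
  cases x with
  | old d =>
    rcases A.dart_cases d with ⟨v, rfl⟩ | ⟨v, h, rfl⟩ | ⟨h, h'⟩
    · rw [A.inv'_t, A.face'_old_some (A.lab_t' v)]; rfl
    · rw [A.inv'_inv_t h (M.inv_inv _), A.face'_old (A.lab_inv_t_eq_none h)]
      simp [face', rot', M.face_rot]
    · rw [A.inv'_old h h']
      simp only [rot', face', A.lab_rot_inv d h h', M.face_rot_inv]
  | s u => exact A.face'_old_some (A.lab_rot_t u)
  | q u => rfl
  | p u => rfl
  | o u =>
    by_cases h : ∃ w, M.inv (A.t u) = A.t w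
    · obtain ⟨w, hw⟩ := h
      rw [A.inv'_o_t hw]
      simp [face', rot', ← hw, M.face_rot_inv]
    · have h : ∀ w, M.inv (A.t u) ≠ A.t w := by simpa using h
      rw [A.inv'_o h]
      exact (A.face'_old (A.lab_rot_inv_t u h)).trans (by rw [M.face_rot_inv]; rfl)
  | n u => simp [face', rot', inv', A.face_rot_t]
  | m u => rfl

end AnnulusData
end CubicMap

/-! ### Insertion of a ring: adjacency of faces, components, Euler's formula. -/

theorem Relation.ReflTransGen.symm_of {α : Type*} {r : α → α → Prop} (hr : ∀ a b, r a b → r b a)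
    {a b : α} (h : Relation.ReflTransGen r a b) : Relation.ReflTransGen r b a := by
  induction h with
  | refl => exact .refl
  | tail _ h ih => exact .head (hr _ _ h) ih

namespace CubicMap

variable {V F D : Type u} {M : CubicMap V F D} {P : Set F}

theorem finite_darts (M : CubicMap V F D) : Finite D := by
  have := M.finite_vert
  exact Finite.of_injective (fun d => (M.tail d, M.tail (M.inv d))) fun d e h =>
    M.tail_inj d e (Prod.ext_iff.1 h).1 (Prod.ext_iff.1 h).2

theorem finite_faces (M : CubicMap V F D) : Finite F := by
  have := M.finite_darts
  exact Finite.of_surjective M.face M.face_surj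

namespace AnnulusData
open AltanDart

variable {U : Type u} (A : M.AnnulusData P U)

theorem finite_labels (A : M.AnnulusData P U) : Finite U := by
  have := M.finite_vert
  exact Finite.of_injective (fun u => M.tail (A.t u)) fun u v h => A.tail_t_inj u v h

/-- Faces that are joined by a dart. -/
def FaceAdj (A : M.AnnulusData P U) (a b : F ⊕ U) : Prop :=
  ∃ x, A.face' x = a ∧ A.face' (A.inv' x) = b

/-- Two faces outside `P` never lose a common edge: an edge `t u` survives as its outer piece at
u'', and the other such edges bear no label on either side. This is what keeps the complement of a
patch connected. -/
theorem faceAdj_of_not_mem {d : D} (h : M.face d ∉ P) (h' : M.face (M.inv d) ∉ P) :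
    A.FaceAdj (Sum.inl (M.face d)) (Sum.inl (M.face (M.inv d))) := by
  rcases A.dart_cases d with ⟨u, rfl⟩ | ⟨u, hu, rfl⟩ | ⟨hd, hd'⟩
  · refine ⟨o u, rfl, ?_⟩
    by_cases hw : ∃ w, M.inv (A.t u) = A.t w
    · obtain ⟨w, hw⟩ := hw
      rw [A.inv'_o_t hw, hw]; rfl
    · have hw : ∀ w, M.inv (A.t u) ≠ A.t w := by simpa using hw
      rw [A.inv'_o hw, A.face'_old (A.lab_inv_t_eq_none hw)]
  · refine ⟨old (M.inv (A.t u)), A.face'_old (A.lab_inv_t_eq_none hu), ?_⟩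
    rw [A.inv'_inv_t hu (M.inv_inv _), M.inv_inv]
    rfl
  · refine ⟨old d, A.face'_old (A.lab_eq_none h' hd), ?_⟩
    rw [A.inv'_old hd hd', A.face'_old (A.lab_eq_none (by rwa [M.inv_inv]) hd')]

theorem ne_t_of_mem {d : D} (h : M.face d ∈ P) (u : U) : d ≠ A.t u := by
  rintro rfl
  exact A.face_t_not_mem u h

theorem inv_ne_t_of_mem {d : D} (h : M.face d ∈ P) (u : U) : M.inv d ≠ A.t u := by
  intro hd
  have := A.face_inv_t u
  rw [← hd, M.inv_inv] at this
  exact this h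

theorem face'_old_of_mem {d : D} (h : M.face d ∈ P) :
    A.face' (old d) = Sum.inl (M.face d) := A.face'_old (A.lab_eq_none_of_mem h)

theorem inv'_old_of_mem {d : D} (h : M.face d ∈ P) :
    A.inv' (old d) = old (M.inv d) := A.inv'_old (A.ne_t_of_mem h) (A.inv_ne_t_of_mem h)

theorem faceAdj_of_mem {d : D} (h : M.face d ∈ P) (h' : M.face (M.inv d) ∈ P) :
    A.FaceAdj (Sum.inl (M.face d)) (Sum.inl (M.face (M.inv d))) :=
  ⟨old d, A.face'_old_of_mem h, by rw [A.inv'_old_of_mem h, A.face'_old_of_mem h']⟩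

theorem faceAdj_symm {a b : F ⊕ U} (h : A.FaceAdj a b) : A.FaceAdj b a := by
  obtain ⟨x, h, h'⟩ := h
  exact ⟨A.inv' x, h', by rw [A.inv'_inv', h]⟩

theorem faceAdj_inr (u : U) : A.FaceAdj (Sum.inl (M.face (M.inv (M.rot (A.t u))))) (Sum.inr u) := by
  refine ⟨old (M.inv (M.rot (A.t u))), A.face'_old_of_mem (A.face_inv_rot_t u), ?_⟩
  rw [A.inv'_old_of_mem (A.face_inv_rot_t u), M.inv_inv]
  exact A.face'_old_some (A.lab_rot_t u)

theorem faceAdj_lab {d : D} {u : U} (h : A.lab d = some u) :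
    A.FaceAdj (Sum.inl (M.face d)) (Sum.inr u) := by
  refine ⟨n u, ?_, by simp [inv', face']⟩
  rw [A.face_eq d u h]
  exact congrArg Sum.inl (A.face_rot_t u)

/-- Only across an edge of the treated perimeter are two old faces pulled apart. There the detour
leads over the ring into the new face and from it across the perimeter edge. -/
theorem reflTransGen_faceAdj (d : D) : Relation.ReflTransGen A.FaceAdj
    (Sum.inl (M.face d)) (Sum.inl (M.face (M.inv d))) := by
  have key : ∀ d, M.face d ∉ P → M.face (M.inv d) ∈ P → Relation.ReflTransGen A.FaceAdj
      (Sum.inl (M.face d)) (Sum.inl (M.face (M.inv d))) := by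
    intro d h h'
    have h1 : A.inv' (old (M.inv d)) = old d := by rw [A.inv'_old_of_mem h', M.inv_inv]
    rcases hl : A.lab d with - | u
    · refine Relation.ReflTransGen.single (A.faceAdj_symm ⟨old (M.inv d), ?_, ?_⟩)
      · exact A.face'_old_of_mem h'
      · rw [h1, A.face'_old hl]
    · refine (Relation.ReflTransGen.single (A.faceAdj_lab hl)).tail
        (A.faceAdj_symm ⟨old (M.inv d), ?_, ?_⟩)
      · exact A.face'_old_of_mem h'
      · rw [h1, A.face'_old_some hl]
  by_cases h : M.face d ∈ P <;> by_cases h' : M.face (M.inv d) ∈ P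
  · exact .single (A.faceAdj_of_mem h h')
  · have := key (M.inv d) h' (by rwa [M.inv_inv])
    rw [M.inv_inv] at this
    exact this.symm_of fun a b => A.faceAdj_symm
  · exact key d h h'
  · exact .single (A.faceAdj_of_not_mem h h')

theorem dual_conn' (a b : F ⊕ U) : Relation.ReflTransGen A.FaceAdj a b := by
  have h1 : ∀ a b : F, Relation.ReflTransGen A.FaceAdj (Sum.inl a) (Sum.inl b) := by
    intro a b
    induction M.dual_conn a b with
    | refl => exact .refl
    | tail _ h ih =>
      obtain ⟨d, rfl, rfl⟩ := h
      exact ih.trans (A.reflTransGen_faceAdj d)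
  have h2 : ∀ u, A.FaceAdj (Sum.inl (M.face (M.inv (M.rot (A.t u))))) (Sum.inr u) := A.faceAdj_inr
  rcases a with a | u <;> rcases b with b | v
  · exact h1 a b
  · exact (h1 _ _).tail (h2 v)
  · exact (Relation.ReflTransGen.single (A.faceAdj_symm (h2 u))).trans (h1 _ _)
  · exact ((Relation.ReflTransGen.single (A.faceAdj_symm (h2 u))).trans (h1 _ _)).tail (h2 v)

/-- Vertices that are joined by a dart. -/
def VertAdj (A : M.AnnulusData P U) (x y : V ⊕ U × Bool) : Prop :=
  ∃ d, A.tail' d = x ∧ A.tail' (A.inv' d) = y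

theorem mk_spoke (u : U) :
    Quot.mk A.VertAdj (Sum.inl (M.tail (A.t u))) = Quot.mk _ (Sum.inr (u, false)) :=
  Quot.sound ⟨old (A.t u), rfl, by rw [A.inv'_t]; rfl⟩

theorem mk_ring (u : U) :
    Quot.mk A.VertAdj (Sum.inr (u, false)) = Quot.mk _ (Sum.inr (u, true)) :=
  Quot.sound ⟨p u, rfl, rfl⟩

/-- A cut edge is replaced by the path u, u', u'', followed by the outer piece; if the other end is
cut as well, the path continues through w'', w', w. -/
theorem mk_inner (u : U) : Quot.mk A.VertAdj (Sum.inl (M.tail (A.t u))) =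
    Quot.mk _ (Sum.inl (M.tail (M.inv (A.t u)))) := by
  rw [mk_spoke, mk_ring]
  by_cases hw : ∃ w, M.inv (A.t u) = A.t w
  · obtain ⟨w, hw⟩ := hw
    rw [hw, mk_spoke, mk_ring]
    exact Quot.sound ⟨o u, rfl, by rw [A.inv'_o_t hw]; rfl⟩
  · exact Quot.sound ⟨o u, rfl, by rw [A.inv'_o (by simpa using hw)]; rfl⟩

theorem mk_old (d : D) : Quot.mk A.VertAdj (Sum.inl (M.tail d)) =
    Quot.mk _ (Sum.inl (M.tail (M.inv d))) := by
  rcases A.dart_cases d with ⟨u, rfl⟩ | ⟨u, hu, rfl⟩ | ⟨hd, hd'⟩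
  · exact A.mk_inner u
  · rw [M.inv_inv]
    exact (A.mk_inner u).symm
  · exact Quot.sound ⟨old d, rfl, by rw [A.inv'_old hd hd']; rfl⟩

/-- The old vertex to which a vertex of the new graph is retracted. -/
def retract (A : M.AnnulusData P U) : V ⊕ U × Bool → V
  | Sum.inl v => v
  | Sum.inr (u, _) => M.tail (A.t u)

/-- Sending u' and u'' to the foot of the spoke maps every edge into a component. For a ring edge
from u'' to the next spoke vertex this uses the path along the perimeter, recorded in the field
`conn`. -/
theorem mk_retract (x : AltanDart D U) :
    Quot.mk (fun u v => ∃ d, M.tail d = u ∧ M.tail (M.inv d) = v) (A.retract (A.tail' x)) =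
      Quot.mk _ (A.retract (A.tail' (A.inv' x))) := by
  have hs : ∀ d, Quot.mk (fun u v => ∃ d, M.tail d = u ∧ M.tail (M.inv d) = v) (M.tail d) =
      Quot.mk _ (M.tail (M.inv d)) := fun d => Quot.sound ⟨d, rfl, rfl⟩
  cases x with
  | old d =>
    rcases A.dart_cases d with ⟨u, rfl⟩ | ⟨u, hu, rfl⟩ | ⟨hd, hd'⟩
    · rw [A.inv'_t]; rfl
    · rw [A.inv'_inv_t hu (M.inv_inv _)]
      exact (hs (A.t u)).symm
    · rw [A.inv'_old hd hd']
      exact hs d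
  | s u => rfl
  | q u =>
    have := A.conn (A.N.symm u)
    rw [A.N.apply_symm_apply] at this
    exact this.symm
  | p u => rfl
  | o u =>
    by_cases hw : ∃ w, M.inv (A.t u) = A.t w
    · obtain ⟨w, hw⟩ := hw
      rw [A.inv'_o_t hw]
      have := hs (A.t u)
      rwa [hw] at this
    · rw [A.inv'_o (by simpa using hw)]
      exact hs (A.t u)
  | n u => exact A.conn u
  | m u => rfl

/-- The retraction and the inclusion of the old vertices induce mutually inverse maps on components.
-/
theorem card_components : Nat.card (Quot A.VertAdj) =
    Nat.card (Quot fun u v => ∃ d, M.tail d = u ∧ M.tail (M.inv d) = v) := by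
  refine Nat.card_congr ⟨Quot.lift (fun x => Quot.mk _ (A.retract x)) ?_,
    Quot.lift (fun v => Quot.mk _ (Sum.inl v)) ?_, ?_, ?_⟩
  · rintro x y ⟨d, rfl, rfl⟩
    exact A.mk_retract d
  · rintro u v ⟨d, rfl, rfl⟩
    exact A.mk_old d
  · rintro ⟨v | ⟨u, b | b⟩⟩
    · rfl
    · exact A.mk_spoke u
    · exact (A.mk_spoke u).trans (A.mk_ring u)
  · rintro ⟨v⟩
    rfl

/-- The cubic map after the insertion of the ring. -/
noncomputable def altan : CubicMap (V ⊕ U × Bool) (F ⊕ U) (AltanDart D U) where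
  finite_vert := by
    have := M.finite_vert
    have := A.finite_labels
    infer_instance
  inv := A.inv'
  inv_inv := A.inv'_inv'
  rot := A.rot'
  tail := A.tail'
  face := A.face'
  tail_inj := A.tail'_inj
  tail_inv_ne := A.tail'_inv'_ne
  rot_rot_rot x := by
    cases x with
    | old d => exact congrArg old (M.rot_rot_rot d)
    | _ => rfl
  rot_ne x := by
    cases x with
    | old d => exact fun h => M.rot_ne d (AltanDart.old.inj h)
    | _ => simp [rot']
  tail_rot x := by
    cases x with
    | old d => exact congrArg Sum.inl (M.tail_rot d)
    | _ => rfl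
  eq_of_tail_eq x y h := by
    cases x with
    | old d =>
      cases y with
      | old e =>
        rcases M.eq_of_tail_eq d e (Sum.inl.inj h) with rfl | rfl | rfl
        · exact Or.inl rfl
        · exact Or.inr (Or.inl rfl)
        · exact Or.inr (Or.inr rfl)
      | _ => simp [tail'] at h
    | _ => cases y <;> simp_all [tail', rot']
  tail_surj x := by
    rcases x with v | ⟨u, b | b⟩
    · obtain ⟨d, rfl⟩ := M.tail_surj v
      exact ⟨old d, rfl⟩
    · exact ⟨s u, rfl⟩
    · exact ⟨o u, rfl⟩
  face_surj x := by
    rcases x with f | u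
    · obtain ⟨d, rfl⟩ := M.face_surj f
      rcases h : A.lab d with - | u
      · exact ⟨old d, A.face'_old h⟩
      -- If the dart has been taken over by a new face, its old face is still seen from the outer
      -- side of the ring, so no hole face vanishes.
      · exact ⟨p (A.N u), congrArg Sum.inl (A.face_eq d u h).symm⟩
    · exact ⟨s u, rfl⟩
  face_rot_inv := A.face'_rot'_inv'
  dual_conn := A.dual_conn'
  euler := by
    have := M.finite_vert
    have := A.finite_labels
    have := M.finite_faces
    have h1 := M.euler
    -- With |U| ring labels, |F| grows by |U| and |V| by 2|U|, while the number of components stays: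
    -- both sides grow by 2|U|.
    rw [Nat.card_sum, Nat.card_sum, Nat.card_prod, Nat.card_eq_fintype_card (α := Bool), Fintype.card_bool]
    change _ = _ + 2 + 2 * Nat.card (Quot A.VertAdj)
    rw [A.card_components]
    lia

/-- The faces of the set together with the new faces. -/
def patch (P : Set F) (U : Type u) : Set (F ⊕ U) := Sum.elim P fun _ => True

theorem inl_mem_patch {f : F} : (Sum.inl f : F ⊕ U) ∈ patch P U ↔ f ∈ P := Iff.rfl

theorem inr_mem_patch (u : U) : (Sum.inr u : F ⊕ U) ∈ patch P U := trivial

/-- Adjacencies inside `P` are untouched, and the new face with label `u` meets `P` across the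
perimeter edge that leaves the foot of the spoke. Properness holds since no face outside `P` is
added. -/
theorem isPerforatedPatch_altan (h : M.IsPerforatedPatch P) :
    A.altan.IsPerforatedPatch (patch P U) := by
  obtain ⟨h1, ⟨f, hf⟩, h2⟩ := h
  refine ⟨fun h => h1 (Set.eq_univ_of_forall fun f => ?_), ⟨Sum.inl f, hf⟩, ?_⟩
  · exact inl_mem_patch.1 (h ▸ Set.mem_univ (Sum.inl f : F ⊕ U))
  · set R := fun a b : F ⊕ U => a ∈ patch P U ∧ b ∈ patch P U ∧ A.FaceAdj a b
    change ∀ a ∈ patch P U, ∀ b ∈ patch P U, Relation.ReflTransGen R a b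
    have hR : ∀ a b, R a b → R b a := fun a b h => ⟨h.2.1, h.1, A.faceAdj_symm h.2.2⟩
    have h3 : ∀ a ∈ P, ∀ b ∈ P, Relation.ReflTransGen R (Sum.inl a) (Sum.inl b) := by
      intro a ha b hb
      refine (h2 a ha b hb).lift Sum.inl ?_
      rintro _ _ ⟨ha, hb, d, rfl, rfl⟩
      exact ⟨ha, hb, A.faceAdj_of_mem ha hb⟩
    have h4 : ∀ u, R (Sum.inl (M.face (M.inv (M.rot (A.t u))))) (Sum.inr u) := fun u =>
      ⟨A.face_inv_rot_t u, inr_mem_patch u, A.faceAdj_inr u⟩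
    have h5 : ∀ a ∈ P, ∀ b ∈ patch P U, Relation.ReflTransGen R (Sum.inl a) b := by
      rintro a ha (b | u) hb
      · exact h3 a ha b hb
      · exact (h3 a ha _ (A.face_inv_rot_t u)).tail (h4 u)
    intro a ha b hb
    exact ((h5 f hf a ha).symm_of hR).trans (h5 f hf b hb)

theorem dualConnected_compl_altan (h : M.DualConnected Pᶜ) :
    A.altan.DualConnected (patch P U)ᶜ := by
  obtain ⟨⟨f, hf⟩, h2⟩ := h
  refine ⟨⟨Sum.inl f, hf⟩, ?_⟩
  rintro (a | u) ha (b | v) hb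
  · refine (h2 a ha b hb).lift Sum.inl ?_
    rintro _ _ ⟨ha, hb, d, rfl, rfl⟩
    exact ⟨ha, hb, A.faceAdj_of_not_mem ha hb⟩
  · exact absurd (inr_mem_patch v) hb
  · exact absurd (inr_mem_patch u) ha
  · exact absurd (inr_mem_patch u) ha

end AnnulusData
end CubicMap

/-! ### Segments of a perimeter between consecutive degree-2 vertices. -/

theorem Cycle.substitute_coe {α β : Type*} (f : α → List β) (l : List α) :
    (l : Cycle α).substitute f = (l.flatMap f : List β) := rfl

namespace HoledComplex

variable {k : ℕ}

/-- The decomposition of a cycle into the segments from a degree-2 vertex to the next one. -/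
structure Segments (S : HoledComplex.{u} k) (j : Fin k) where
  N : Equiv.Perm (S.deg2 j)
  gap : S.deg2 j → List S.Vert
  N_ne : ∀ u, N u ≠ u
  not_mem_deg2 : ∀ u, ∀ x ∈ gap u, x ∉ S.deg2 j
  eq_of_mem : ∀ u v x, x ∈ gap u → x ∈ gap v → u = v
  cover : ∀ x ∈ S.perimeter j, ∃ u : S.deg2 j, x ∈ (u : S.Vert) :: gap u
  split : ∀ u : S.deg2 j, ∃ b, S.perimeter j =
    (((u : S.Vert) :: (gap u ++ (N u : S.Vert) :: b) : List S.Vert) : Cycle S.Vert)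
  new_split : ∀ u : S.deg2 j, ∃ b, S.newPerimeter j = ((Sum.inr (u, false) :: Sum.inr (u, true) ::
    Sum.inr (N u, false) :: b : List (S.AltanVert j)) : Cycle _)
  new_nodup : (S.newPerimeter j).Nodup
  mem_new : ∀ x, x ∈ S.newPerimeter j ↔ ∃ y, x = Sum.inr y

/-- Open the perimeter at a degree-2 vertex and cut it in front of every such vertex. The cyclic
order of the block heads is a cycle permutation, `List.formPerm`, and the substitution defining the
new cycle sees the heads only. -/
theorem exists_segments (S : HoledComplex.{u} k) (j : Fin k) (hn : (S.perimeter j).Nodup)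
    (h2 : 2 ≤ (S.deg2 j).ncard) : Nonempty (S.Segments j) := by
  classical
  obtain ⟨u₀, hu₀⟩ : (S.deg2 j).Nonempty := Set.nonempty_of_ncard_ne_zero (by lia)
  obtain ⟨l, hl⟩ := Cycle.exists_eq_coe_cons hu₀.1
  obtain ⟨L₀, hL₀, hL⟩ := List.exists_flatMap_blocks (· ∈ S.deg2 j) (u₀ :: l)
    (by simpa using hu₀)
  have hnod : (L₀.flatMap fun B => B.1 :: B.2).Nodup := by
    rw [← hL₀, ← Cycle.nodup_coe_iff, ← hl]; exact hn
  have hmem : ∀ x, x ∈ S.perimeter j ↔ ∃ B ∈ L₀, x ∈ B.1 :: B.2 := by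
    intro x
    rw [hl, Cycle.mem_coe_iff, hL₀, List.mem_flatMap]
  have hu : ∀ u : S.deg2 j, ∃ a, ((u : S.Vert), a) ∈ L₀ := by
    intro u
    obtain ⟨B, hB, hx⟩ := (hmem u).1 u.2.1
    rcases List.mem_cons.1 hx with h | h
    · exact ⟨B.2, by rw [h]; exact hB⟩
    · exact absurd u.2 ((hL B hB).2 _ h)
  choose gap hgap using hu
  have hpw := (List.nodup_flatMap.1 hnod).2
  have hdisj : ∀ B ∈ L₀, ∀ B' ∈ L₀, ∀ x, x ∈ B.1 :: B.2 → x ∈ B'.1 :: B'.2 → B = B' := by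
    intro B hB B' hB' x hx hx'
    by_contra hne
    have : Std.Symm (Function.onFun List.Disjoint fun B : S.Vert × List S.Vert => B.1 :: B.2) :=
      ⟨fun _ _ h => List.Disjoint.symm h⟩
    exact hpw.forall hB hB' hne hx hx'
  have heq : ∀ B ∈ L₀, B ∈ Set.range fun u : S.deg2 j => ((u : S.Vert), gap u) := by
    intro B hB
    refine ⟨⟨B.1, (hL B hB).1⟩, ?_⟩
    exact hdisj _ (hgap _) _ hB B.1 (by simp) (by simp)
  obtain ⟨L, rfl⟩ := List.exists_map_eq heq
  have hLn : L.Nodup := by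
    refine List.Nodup.of_map (fun u : S.deg2 j => ((u : S.Vert), gap u)) ?_
    refine hpw.imp ?_
    rintro B B' h rfl
    exact h (a := B.1) (by simp) (by simp)
  have hLm : ∀ u, u ∈ L := by
    intro u
    obtain ⟨v, hv, h⟩ := List.mem_map.1 (hgap u)
    rwa [← Subtype.ext (Prod.ext_iff.1 h).1]
  have hper : S.perimeter j = (L : Cycle (S.deg2 j)).substitute fun u : S.deg2 j => (u : S.Vert) :: gap u := by
    rw [hl, hL₀, Cycle.substitute_coe, List.flatMap_map]
  have hgap2 : ∀ u, ∀ x ∈ gap u, x ∉ S.deg2 j := fun u => (hL _ (hgap u)).2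
  have hnew : S.newPerimeter j = (L : Cycle _).substitute fun u : S.deg2 j =>
      ([Sum.inr (u, false), Sum.inr (u, true)] : List (S.AltanVert j)) := by
    rw [newPerimeter, hper]
    simp only [Cycle.substitute_coe, List.flatMap_assoc]
    congr 2
    funext u
    rw [List.flatMap_cons, dif_pos u.2, List.flatMap_eq_nil_iff.2]
    · simp
    · intro x hx
      rw [dif_neg (hgap2 u x hx)]
  have hrot : ∀ u : S.deg2 j, ∃ L', (L : Cycle (S.deg2 j)) =
      ((u :: L.formPerm u :: L' : List (S.deg2 j)) : Cycle (S.deg2 j)) := by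
    intro u
    obtain ⟨L', hL'⟩ := Cycle.exists_eq_coe_cons (Cycle.mem_coe_iff.2 (hLm u))
    have hr := Cycle.coe_eq_coe.1 hL'
    have hn' : (u :: L').Nodup := hr.nodup_iff.1 hLn
    cases L' with
    | nil =>
      -- A single block would leave only one degree-2 vertex.
      have : S.deg2 j ⊆ {(u : S.Vert)} := by
        intro x hx
        have := hr.mem_iff.1 (hLm ⟨x, hx⟩)
        simp at this
        simp [← this]
      have := Set.ncard_le_ncard this
      rw [Set.ncard_singleton] at this
      lia
    | cons v L' =>
      refine ⟨L', ?_⟩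
      rw [hL', List.formPerm_eq_of_isRotated hLn hr, List.formPerm_apply_head _ _ _ hn']
  refine ⟨⟨L.formPerm, gap, ?_, hgap2, ?_, ?_, ?_, ?_, ?_, ?_⟩⟩
  · intro u h
    obtain ⟨L', hL'⟩ := hrot u
    have hn' : (u :: L.formPerm u :: L').Nodup := (Cycle.coe_eq_coe.1 hL').nodup_iff.1 hLn
    rw [h] at hn'
    simp at hn'
  · intro u v x hx hx'
    have := hdisj _ (hgap u) _ (hgap v) x (by simp [hx]) (by simp [hx'])
    exact Subtype.ext (Prod.ext_iff.1 this).1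
  · intro x hx
    obtain ⟨B, hB, hx⟩ := (hmem x).1 hx
    obtain ⟨u, -, rfl⟩ := List.mem_map.1 hB
    exact ⟨u, hx⟩
  · intro u
    obtain ⟨L', hL'⟩ := hrot u
    refine ⟨gap (L.formPerm u) ++ L'.flatMap fun u : S.deg2 j => (u : S.Vert) :: gap u, ?_⟩
    rw [hper, hL', Cycle.substitute_coe]
    simp only [List.flatMap_cons, List.cons_append]
  · intro u
    obtain ⟨L', hL'⟩ := hrot u
    rw [hnew, hL', Cycle.substitute_coe]
    exact ⟨_, rfl⟩
  · rw [hnew, Cycle.substitute_coe, Cycle.nodup_coe_iff, List.nodup_flatMap]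
    refine ⟨by simp, hLn.imp ?_⟩
    intro u v huv
    simp [Function.onFun, List.Disjoint, huv]
  · intro x
    rw [hnew, Cycle.substitute_coe, Cycle.mem_coe_iff, List.mem_flatMap]
    constructor
    · rintro ⟨u, -, h⟩
      simp at h
      rcases h with rfl | rfl <;> exact ⟨_, rfl⟩
    · rintro ⟨⟨u, b | b⟩, rfl⟩ <;> exact ⟨u, hLm u, by simp⟩

end HoledComplex

/-! ### The graph of the altan: degrees and 2-connectedness. -/

theorem SimpleGraph.Connected.of_hom {α β : Type*} {H : SimpleGraph α} {K : SimpleGraph β}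
    (hH : H.Connected) (f : α → β) (hf : ∀ a b, H.Adj a b → K.Adj (f a) (f b))
    (hK : ∀ y, ∃ x, K.Reachable y (f x)) : K.Connected := by
  have hr : ∀ a b, K.Reachable (f a) (f b) := fun a b =>
    (hH.preconnected a b).map (⟨f, fun {a b} h => hf a b h⟩ : H →g K)
  obtain ⟨a⟩ := hH.nonempty
  have : Nonempty β := ⟨f a⟩
  refine ⟨fun y z => ?_⟩
  obtain ⟨a, ha⟩ := hK y
  obtain ⟨b, hb⟩ := hK z
  exact ha.trans ((hr a b).trans hb.symm)

namespace HoledComplex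

variable {k : ℕ}

/-- The graph of the altan at the `j`-th cycle. -/
def altanGraph (S : HoledComplex.{u} k) (j : Fin k) : SimpleGraph (S.AltanVert j) :=
  SimpleGraph.fromRel (S.AltanEdge j)

variable {S : HoledComplex.{u} k} {j : Fin k}

namespace Segments

/-- Since the new cycle has no repetitions, its representative starting at `x` is unique, so "`y`
follows `x`" can be read off from one representative. This turns the edges `AltanEdge.ring` into
explicit ones. -/
theorem newPerimeter_eq_iff (Z : S.Segments j) (x y : S.AltanVert j) :
    (∃ l, S.newPerimeter j = ((x :: y :: l : List (S.AltanVert j)) : Cycle (S.AltanVert j))) ↔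
      (∃ u, x = Sum.inr (u, false) ∧ y = Sum.inr (u, true)) ∨
        ∃ u, x = Sum.inr (u, true) ∧ y = Sum.inr (Z.N u, false) := by
  have hex : ∀ u : S.deg2 j, ∃ l, S.newPerimeter j = ((Sum.inr (u, true) ::
      Sum.inr (Z.N u, false) :: l : List (S.AltanVert j)) : Cycle _) := by
    intro u
    obtain ⟨b, hb⟩ := Z.new_split u
    exact ⟨b ++ [Sum.inr (u, false)], hb.trans (Cycle.coe_cons_eq_coe_append _ _)⟩
  constructor
  · rintro ⟨l, hl⟩
    have hnod : (x :: y :: l).Nodup := by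
      rw [← Cycle.nodup_coe_iff, ← hl]; exact Z.new_nodup
    obtain ⟨⟨u, b⟩, rfl⟩ := (Z.mem_new x).1 (by rw [hl]; simp)
    cases b with
    | false =>
      obtain ⟨b, hb⟩ := Z.new_split u
      have := Cycle.coe_cons_inj hnod (hl.symm.trans hb)
      exact Or.inl ⟨u, rfl, (List.cons.inj this).1⟩
    | true =>
      obtain ⟨b, hb⟩ := hex u
      have := Cycle.coe_cons_inj hnod (hl.symm.trans hb)
      exact Or.inr ⟨u, rfl, (List.cons.inj this).1⟩
  · rintro (⟨u, rfl, rfl⟩ | ⟨u, rfl, rfl⟩)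
    · obtain ⟨b, hb⟩ := Z.new_split u
      exact ⟨_, hb⟩
    · exact hex u

theorem altanEdge_iff (Z : S.Segments j) (x y : S.AltanVert j) : S.AltanEdge j x y ↔
    (∃ u v, S.graph.Adj u v ∧ x = Sum.inl u ∧ y = Sum.inl v) ∨
    (∃ v : S.deg2 j, x = Sum.inl (v : S.Vert) ∧ y = Sum.inr (v, false)) ∨
      (∃ u, x = Sum.inr (u, false) ∧ y = Sum.inr (u, true)) ∨
        ∃ u, x = Sum.inr (u, true) ∧ y = Sum.inr (Z.N u, false) := by
  rw [← Z.newPerimeter_eq_iff]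
  constructor
  · rintro (h | v | h)
    · exact Or.inl ⟨_, _, h, rfl, rfl⟩
    · exact Or.inr (Or.inl ⟨v, rfl, rfl⟩)
    · exact Or.inr (Or.inr ⟨_, h⟩)
  · rintro (⟨u, v, h, rfl, rfl⟩ | ⟨v, rfl, rfl⟩ | ⟨l, h⟩)
    · exact .old h
    · exact .spoke v
    · exact .ring h

theorem adj_inl_inl (Z : S.Segments j) (u v : S.Vert) :
    (S.altanGraph j).Adj (Sum.inl u) (Sum.inl v) ↔ S.graph.Adj u v := by
  simp only [altanGraph, SimpleGraph.fromRel_adj, Z.altanEdge_iff, Sum.inl.injEq, ne_eq, reduceCtorEq,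
    and_false, exists_false, or_false]
  constructor
  · rintro ⟨-, ⟨u, v, h, rfl, rfl⟩ | ⟨u, v, h, rfl, rfl⟩⟩
    · exact h
    · exact h.symm
  · intro h
    exact ⟨h.ne, Or.inl ⟨u, v, h, rfl, rfl⟩⟩

theorem adj_inl_inr (Z : S.Segments j) (u : S.Vert) (v : S.deg2 j) (b : Bool) :
    (S.altanGraph j).Adj (Sum.inl u) (Sum.inr (v, b)) ↔ u = v ∧ b = false := by
  simp only [altanGraph, SimpleGraph.fromRel_adj, Z.altanEdge_iff, Sum.inl.injEq, ne_eq, reduceCtorEq,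
    false_and, and_false, exists_false, or_false, false_or, not_false_eq_true, true_and,
    Sum.inr.injEq, Prod.mk.injEq]
  constructor
  · rintro ⟨w, rfl, rfl, rfl⟩
    exact ⟨rfl, rfl⟩
  · rintro ⟨rfl, rfl⟩
    exact ⟨v, rfl, rfl, rfl⟩

theorem adj_inr_inr (Z : S.Segments j) (u v : S.deg2 j) (b b' : Bool) :
    (S.altanGraph j).Adj (Sum.inr (u, b)) (Sum.inr (v, b')) ↔
      (b = false ∧ b' = true ∧ (u = v ∨ u = Z.N v)) ∨
        (b = true ∧ b' = false ∧ (v = u ∨ v = Z.N u)) := by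
  simp only [altanGraph, SimpleGraph.fromRel_adj, Z.altanEdge_iff, ne_eq, reduceCtorEq,
    false_and, and_false, exists_false, false_or, Sum.inr.injEq, Prod.mk.injEq]
  cases b <;> cases b' <;> simp <;> grind

/-- This makes the operation repeatable. On the new cycle the vertices u'' have only their two ring
neighbours, and there are as many of them as there were degree-2 vertices. The other cycles are
disjoint from the treated one, so their vertices receive no spokes. -/
theorem two_le_ncard_deg2 (Z : S.Segments j) (h2 : 2 ≤ (S.deg2 j).ncard) [Finite S.Vert]
    (hdisj : ∀ i, i ≠ j → ∀ x ∈ S.perimeter i, x ∉ S.perimeter j) (i : Fin k)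
    (hi : 2 ≤ (S.deg2 i).ncard) : 2 ≤ ((S.altanAt j).deg2 i).ncard := by
  have hfin : Finite (S.AltanVert j) := inferInstance
  have hfin : Finite (S.altanAt j).Vert := hfin
  by_cases hij : i = j
  · subst hij
    refine h2.trans ?_
    have hinj : Function.Injective fun u : S.deg2 i => (Sum.inr (u, true) : S.AltanVert i) := by
      intro u v h
      simpa using h
    rw [← Nat.card_coe_set_eq, ← Set.ncard_univ, ← Set.ncard_image_of_injective _ hinj]
    refine Set.ncard_le_ncard ?_
    rintro _ ⟨u, -, rfl⟩
    refine ⟨?_, ?_⟩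
    · change _ ∈ (if i = i then S.newPerimeter i else _)
      rw [if_pos rfl, Z.mem_new]
      exact ⟨_, rfl⟩
    · change ((S.altanGraph i).neighborSet (Sum.inr (u, true))).ncard = 2
      have : (S.altanGraph i).neighborSet (Sum.inr (u, true)) =
          {Sum.inr (u, false), Sum.inr (Z.N u, false)} := by
        ext x
        rw [SimpleGraph.mem_neighborSet]
        rcases x with x | ⟨v, b⟩
        · rw [SimpleGraph.adj_comm, Z.adj_inl_inr]
          simp
        · rw [Z.adj_inr_inr]
          simp
          grind
      rw [this, Set.ncard_pair]
      simpa using (Z.N_ne u).symm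
  · refine hi.trans ?_
    rw [← Set.ncard_image_of_injective _ (Sum.inl_injective (β := S.deg2 j × Bool))]
    refine Set.ncard_le_ncard ?_
    rintro _ ⟨x, hx, rfl⟩
    have hxj := hdisj i hij x hx.1
    refine ⟨?_, ?_⟩
    · change _ ∈ (if i = j then S.newPerimeter j else _)
      rw [if_neg hij]
      exact Cycle.mem_map.2 ⟨x, hx.1, rfl⟩
    · change ((S.altanGraph j).neighborSet (Sum.inl x)).ncard = 2
      have : (S.altanGraph j).neighborSet (Sum.inl x) = Sum.inl '' S.graph.neighborSet x := by
        ext y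
        rw [SimpleGraph.mem_neighborSet]
        rcases y with y | ⟨v, b⟩
        · rw [Z.adj_inl_inl]
          simp
        · rw [Z.adj_inl_inr]
          simp only [Set.mem_image, reduceCtorEq, and_false, exists_false, iff_false, not_and]
          rintro rfl
          exact absurd v.2.1 hxj
      rw [this, Set.ncard_image_of_injective _ Sum.inl_injective, hx.2]

theorem spoke (Z : S.Segments j) (u : S.deg2 j) :
    (S.altanGraph j).Adj (Sum.inr (u, false)) (Sum.inl (u : S.Vert)) :=
  ((Z.adj_inl_inr _ _ _).2 ⟨rfl, rfl⟩).symm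

theorem ring (Z : S.Segments j) (u : S.deg2 j) : (S.altanGraph j).Adj (Sum.inr (u, true)) (Sum.inr (u, false)) :=
  (Z.adj_inr_inr _ _ _ _).2 (Or.inr ⟨rfl, rfl, Or.inl rfl⟩)

theorem ring_next (Z : S.Segments j) (u : S.deg2 j) :
    (S.altanGraph j).Adj (Sum.inr (u, true)) (Sum.inr (Z.N u, false)) :=
  (Z.adj_inr_inr _ _ _ _).2 (Or.inr ⟨rfl, rfl, Or.inr rfl⟩)

theorem connected_altanGraph (Z : S.Segments j) (h : S.graph.Connected) : (S.altanGraph j).Connected := by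
  refine h.of_hom Sum.inl (fun a b => (Z.adj_inl_inl a b).2) ?_
  have hs : ∀ u : S.deg2 j, (S.altanGraph j).Reachable (Sum.inr (u, false)) (Sum.inl (u : S.Vert)) :=
    fun u => (Z.spoke u).reachable
  rintro (v | ⟨u, b | b⟩)
  · exact ⟨v, .refl _⟩
  · exact ⟨u, hs u⟩
  · exact ⟨u, (Z.ring u).reachable.trans (hs u)⟩

/-- The old graph, minus the deleted vertex if that is an old one, is connected, so it is enough
that every remaining ring vertex reaches a remaining old vertex. It does so by its own spoke or by
the next one, and the two spokes have distinct feet. -/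
theorem twoConnected_altanGraph (Z : S.Segments j) [Finite S.Vert] (h : S.graph.TwoConnected) :
    (S.altanGraph j).TwoConnected := by
  obtain ⟨h3, hc, hd⟩ := h
  refine ⟨h3.trans (Nat.card_le_card_of_injective (β := S.AltanVert j) Sum.inl Sum.inl_injective),
    Z.connected_altanGraph hc, ?_⟩
  have adj : ∀ (z x y : S.AltanVert j) (hx : x ∈ ({z} : Set _)ᶜ) (hy : y ∈ ({z} : Set _)ᶜ),
      (S.altanGraph j).Adj x y →
      ((S.altanGraph j).induce {z}ᶜ).Reachable ⟨x, hx⟩ ⟨y, hy⟩ := by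
    intro z x y hx hy h
    exact SimpleGraph.Adj.reachable (SimpleGraph.comap_adj.2 h)
  rintro (v | ⟨u, b⟩)
  · refine (hd v).of_hom (fun x => ⟨Sum.inl x.1, ?_⟩) ?_ ?_
    · exact fun h => x.2 (Sum.inl.inj h)
    · rintro ⟨a, ha⟩ ⟨b, hb⟩ h
      exact SimpleGraph.comap_adj.2 ((Z.adj_inl_inl a b).2 (SimpleGraph.comap_adj.1 h))
    · have hs : ∀ w : S.deg2 j, (w : S.Vert) ≠ v → ∃ x : ({v}ᶜ : Set S.Vert),
          ((S.altanGraph j).induce {Sum.inl v}ᶜ).Reachable ⟨Sum.inr (w, false), by simp⟩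
            ⟨Sum.inl x.1, fun h => x.2 (Sum.inl.inj h)⟩ := fun w hw =>
        ⟨⟨w, hw⟩, adj _ _ _ _ _ (Z.spoke w)⟩
      have hn : ∀ w : S.deg2 j, ∃ x : ({v}ᶜ : Set S.Vert),
          ((S.altanGraph j).induce {Sum.inl v}ᶜ).Reachable ⟨Sum.inr (w, true), by simp⟩
            ⟨Sum.inl x.1, fun h => x.2 (Sum.inl.inj h)⟩ := by
        intro w
        -- If the foot of the spoke at `w` is deleted, the ring edge to the next spoke helps, whose
        -- foot `N w` is another vertex.
        by_cases hw : (w : S.Vert) = v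
        · obtain ⟨x, hx⟩ := hs (Z.N w) (fun h => Z.N_ne w (Subtype.ext (h.trans hw.symm)))
          exact ⟨x, (adj _ _ _ _ _ (Z.ring_next w)).trans hx⟩
        · obtain ⟨x, hx⟩ := hs w hw
          exact ⟨x, (adj _ _ _ _ _ (Z.ring w)).trans hx⟩
      rintro ⟨x | ⟨w, b | b⟩, hx⟩
      · exact ⟨⟨x, by simpa using hx⟩, .refl _⟩
      · obtain ⟨x, hx⟩ := hn w
        exact ⟨x, (adj _ _ _ _ _ (Z.ring w).symm).trans hx⟩
      · exact hn w
  · refine hc.of_hom (fun x => ⟨Sum.inl x, by simp⟩)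
      (fun a b h => SimpleGraph.comap_adj.2 ((Z.adj_inl_inl a b).2 h)) ?_
    have hs : ∀ (w : S.deg2 j) (hw : (Sum.inr (w, false) : S.AltanVert j) ∈
        ({Sum.inr (u, b)} : Set (S.AltanVert j))ᶜ), ∃ x : S.Vert,
          ((S.altanGraph j).induce {Sum.inr (u, b)}ᶜ).Reachable ⟨Sum.inr (w, false), hw⟩
            ⟨Sum.inl x, by simp⟩ := fun w hw => ⟨w, adj _ _ _ _ _ (Z.spoke w)⟩
    rintro ⟨x | ⟨w, b' | b'⟩, hx⟩
    · exact ⟨x, .refl _⟩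
    · exact hs w hx
    · by_cases hw : (Sum.inr (w, false) : S.AltanVert j) ∈ ({Sum.inr (u, b)} : Set (S.AltanVert j))ᶜ
      · obtain ⟨x, hx⟩ := hs w hw
        exact ⟨x, (adj _ _ _ _ _ (Z.ring w)).trans hx⟩
      -- Here w' is the deleted vertex, so w'' escapes through the next spoke.
      · simp only [Set.mem_compl_iff, Set.mem_singleton_iff, not_not, Sum.inr.injEq,
          Prod.mk.injEq] at hw
        obtain ⟨rfl, rfl⟩ := hw
        obtain ⟨x, hx⟩ := hs (Z.N w) (by simpa using Z.N_ne w)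
        exact ⟨x, (adj _ _ _ _ _ (Z.ring_next w)).trans hx⟩

end Segments

end HoledComplex

/-! ### Realisations of a complex, and the hole boundary along a perimeter. -/

namespace CubicMap

variable {V F D : Type u} {M : CubicMap V F D} {P : Set F} {k : ℕ}

/-- The complex `S` consists of the faces in `P` with all perimeters of `P`, the vertices being
renamed by `φ`. -/
structure Realizes (M : CubicMap V F D) (P : Set F) (S : HoledComplex.{u} k) (φ : S.Vert → V) :
    Prop where
  inj : Function.Injective φ
  vert : ∀ v, v ∈ Set.range φ ↔ ∃ d, M.tail d = v ∧ M.face d ∈ P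
  adj : ∀ x y, S.graph.Adj x y ↔ ∃ d, M.tail d = φ x ∧ M.tail (M.inv d) = φ y ∧
    (M.face d ∈ P ∨ M.face (M.inv d) ∈ P)
  faces : ∀ s, s ∈ S.faces ↔ ∃ f ∈ P, s = {c | M.IsFacialWalk f (c.map φ)}
  perimeter_inj : Function.Injective S.perimeter
  perimeter : ∀ c, c ∈ Set.range S.perimeter ↔ M.IsPerimeter P (c.map φ)

theorem tail_mem_vert {d : D} (h : M.face d ∈ P ∨ M.face (M.inv d) ∈ P) :
    ∃ e, M.tail e = M.tail d ∧ M.face e ∈ P := by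
  rcases h with h | h
  · exact ⟨d, rfl, h⟩
  · exact ⟨M.rot d, M.tail_rot d, by rwa [M.face_rot]⟩

theorem IsBoundary.eq_of_head_eq {d e : D} (hd : M.IsBoundary P d) (he : M.IsBoundary P e)
    (h : M.tail (M.inv d) = M.tail (M.inv e)) : d = e := by
  refine M.inv_injective ?_
  rcases M.eq_of_tail_eq _ _ h with h | h | h
  · exact h.symm
  · have := he.2
    rw [h, M.face_rot, M.inv_inv] at this
    exact absurd this hd.1
  · have h1 := hd.2
    rw [← M.rot_rot_rot (M.inv d), ← h, M.face_rot, M.inv_inv] at h1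
    exact absurd h1 he.1

namespace Realizes

variable {S : HoledComplex.{u} k} {φ : S.Vert → V} (R : M.Realizes P S φ)

theorem finite_vert (R : M.Realizes P S φ) : Finite S.Vert :=
  have := M.finite_vert
  Finite.of_injective φ R.inj

theorem isPerimeter (R : M.Realizes P S φ) (i : Fin k) :
    M.IsPerimeter P ((S.perimeter i).map φ) := (R.perimeter _).1 ⟨i, rfl⟩

theorem nodup (R : M.Realizes P S φ) (i : Fin k) : (S.perimeter i).Nodup :=
  (R.isPerimeter i).2.1.of_map

theorem chain (R : M.Realizes P S φ) (i : Fin k) :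
    (S.perimeter i).Chain fun x y => M.BoundaryRel P (φ x) (φ y) :=
  (Cycle.chain_map φ).1 (R.isPerimeter i).2.2

theorem disjoint (R : M.Realizes P S φ) {i j : Fin k} (hij : i ≠ j) :
    ∀ x ∈ S.perimeter i, x ∉ S.perimeter j := by
  intro x hx hx'
  have := (R.isPerimeter i).eq_of_mem (R.isPerimeter j) (Cycle.mem_map.2 ⟨x, hx, rfl⟩)
    (Cycle.mem_map.2 ⟨x, hx', rfl⟩)
  exact hij (R.perimeter_inj (Cycle.map_injective R.inj this))

theorem exists_boundary (R : M.Realizes P S φ) (j : Fin k) : ∃ b : S.Vert → D,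
    ∀ x ∈ S.perimeter j, M.tail (b x) = φ x ∧ M.IsBoundary P (b x) := by
  obtain ⟨x, hx⟩ := Cycle.exists_mem_of_ne_nil
    (fun h => (R.isPerimeter j).1 (by rw [h]; rfl) : S.perimeter j ≠ Cycle.nil)
  have h : ∀ x ∈ S.perimeter j, ∃ d, M.tail d = φ x ∧ M.IsBoundary P d := by
    intro x hx
    obtain ⟨y, -, d, h1, -, h2⟩ := Cycle.exists_rel_of_chain (R.chain j) hx
    exact ⟨d, h1, h2⟩
  obtain ⟨d, -⟩ := h x hx
  have : Nonempty D := ⟨d⟩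
  choose! b hb using h
  exact ⟨b, hb⟩

/-- A vertex of a perimeter has degree 2 if and only if its third edge lies in the hole. -/
theorem ncard_neighborSet_eq_two_iff (R : M.Realizes P S φ) {x : S.Vert} {b : D}
    (hx : M.tail b = φ x) (hb : M.IsBoundary P b) :
    (S.graph.neighborSet x).ncard = 2 ↔ M.face (M.rot (M.rot b)) ∉ P := by
  have h1 : φ '' S.graph.neighborSet x = (fun e => M.tail (M.inv e)) ''
      {e | M.tail e = φ x ∧ (M.face e ∈ P ∨ M.face (M.inv e) ∈ P)} := by
    ext v
    constructor
    · rintro ⟨y, hy, rfl⟩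
      obtain ⟨d, h1, h2, h3⟩ := (R.adj x y).1 hy
      exact ⟨d, ⟨h1, h3⟩, h2⟩
    · rintro ⟨d, ⟨h1, h2⟩, rfl⟩
      obtain ⟨y, hy⟩ := (R.vert (M.tail (M.inv d))).2
        (tail_mem_vert (by rw [M.inv_inv]; exact h2.symm))
      exact ⟨y, (R.adj x y).2 ⟨d, h1, hy.symm, h2⟩, hy⟩
  have h2 : (S.graph.neighborSet x).ncard =
      {e | M.tail e = φ x ∧ (M.face e ∈ P ∨ M.face (M.inv e) ∈ P)}.ncard := by
    rw [← Set.ncard_image_of_injective _ R.inj, h1, Set.InjOn.ncard_image]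
    rintro d ⟨hd, -⟩ e ⟨he, -⟩ hde
    exact M.tail_inj d e (hd.trans he.symm) hde
  rw [h2]
  have h3 : ∀ e, M.tail e = φ x ↔ e = b ∨ e = M.rot b ∨ e = M.rot (M.rot b) := by
    intro e
    constructor
    · exact fun h => M.eq_of_tail_eq b e (hx.trans h.symm)
    · rintro (rfl | rfl | rfl)
      · exact hx
      · rw [M.tail_rot, hx]
      · rw [M.tail_rot, M.tail_rot, hx]
  -- Two of the three sectors at the vertex are known: the one left of `b` is outside `P` and the
  -- one left of `rot b` is in `P`. Hence `b` and `rot b` always count, and the third dart counts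
  -- exactly if the last sector is in `P`.
  have h4 : M.face (M.rot b) ∈ P := by rw [M.face_rot]; exact hb.2
  have h5 : M.face (M.inv (M.rot (M.rot b))) ∉ P := by
    rw [← M.face_rot, M.rot_rot_rot]; exact hb.1
  by_cases h : M.face (M.rot (M.rot b)) ∈ P
  · have : {e | M.tail e = φ x ∧ (M.face e ∈ P ∨ M.face (M.inv e) ∈ P)} =
        {b, M.rot b, M.rot (M.rot b)} := by
      ext e
      simp only [Set.mem_ofPred_eq, h3, Set.mem_insert_iff, Set.mem_singleton_iff,
        and_iff_left_iff_imp]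
      rintro (rfl | rfl | rfl)
      · exact Or.inr hb.2
      · exact Or.inl h4
      · exact Or.inl h
    have h6 : ({b, M.rot b, M.rot (M.rot b)} : Set D).ncard = 3 :=
      Set.ncard_eq_three.2 ⟨_, _, _, (M.rot_ne b).symm, (M.rot_rot_ne b).symm,
        (M.rot_ne _).symm, rfl⟩
    rw [this, h6]
    simp [h]
  · have : {e | M.tail e = φ x ∧ (M.face e ∈ P ∨ M.face (M.inv e) ∈ P)} = {b, M.rot b} := by
      ext e
      simp only [Set.mem_ofPred_eq, h3, Set.mem_insert_iff, Set.mem_singleton_iff]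
      constructor
      · rintro ⟨rfl | rfl | rfl, h'⟩
        · exact Or.inl rfl
        · exact Or.inr rfl
        · exact absurd h' (by tauto)
      · rintro (rfl | rfl)
        · exact ⟨Or.inl rfl, Or.inr hb.2⟩
        · exact ⟨Or.inr (Or.inl rfl), Or.inl h4⟩
    rw [this, Set.ncard_pair (M.rot_ne b).symm]
    simp [h]

end Realizes

/-- The boundary darts at the vertices of the `j`-th perimeter, and its segments. -/
structure PerimeterData (M : CubicMap V F D) (P : Set F) (S : HoledComplex.{u} k) (φ : S.Vert → V)
    (j : Fin k) where
  R : M.Realizes P S φ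
  Z : S.Segments j
  b : S.Vert → D
  tail_b : ∀ x ∈ S.perimeter j, M.tail (b x) = φ x
  isBoundary_b : ∀ x ∈ S.perimeter j, M.IsBoundary P (b x)

namespace PerimeterData

variable {S : HoledComplex.{u} k} {φ : S.Vert → V} {j : Fin k} (Q : M.PerimeterData P S φ j)

/-- The third dart at a vertex of the perimeter. -/
def t (x : S.Vert) : D := M.rot (M.rot (Q.b x))

theorem rot_t (x : S.Vert) : M.rot (Q.t x) = Q.b x := M.rot_rot_rot _

theorem tail_t {x : S.Vert} (hx : x ∈ S.perimeter j) : M.tail (Q.t x) = φ x := by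
  rw [t, M.tail_rot, M.tail_rot, Q.tail_b x hx]

theorem face_inv_t {x : S.Vert} (hx : x ∈ S.perimeter j) : M.face (M.inv (Q.t x)) ∉ P := by
  rw [← M.face_rot, Q.rot_t]
  exact (Q.isBoundary_b x hx).1

theorem mem_deg2_iff {x : S.Vert} (hx : x ∈ S.perimeter j) :
    x ∈ S.deg2 j ↔ M.face (Q.t x) ∉ P := by
  rw [t, ← Q.R.ncard_neighborSet_eq_two_iff (Q.tail_b x hx) (Q.isBoundary_b x hx)]
  exact ⟨fun h => h.2, fun h => ⟨hx, h⟩⟩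

theorem b_injective {x y : S.Vert} (hx : x ∈ S.perimeter j) (hy : y ∈ S.perimeter j)
    (h : Q.b x = Q.b y) : x = y :=
  Q.R.inj (by rw [← Q.tail_b x hx, h, Q.tail_b y hy])

theorem b_ne_t {x y : S.Vert} (hx : x ∈ S.perimeter j) (hy : y ∈ S.perimeter j) :
    Q.b x ≠ Q.t y := by
  intro h
  exact Q.face_inv_t hy (h ▸ (Q.isBoundary_b x hx).2)

theorem head_b {x y : S.Vert} (hx : x ∈ S.perimeter j) (h : M.BoundaryRel P (φ x) (φ y)) :
    M.tail (M.inv (Q.b x)) = φ y := by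
  obtain ⟨d, h1, h2, h3⟩ := h
  rw [(Q.isBoundary_b x hx).eq_of_tail_eq h3 ((Q.tail_b x hx).trans h1.symm), h2]

/-- The dart following a boundary dart on the boundary of the hole. -/
theorem rot_inv_b {x y : S.Vert} (hx : x ∈ S.perimeter j) (hy : y ∈ S.perimeter j)
    (h : M.BoundaryRel P (φ x) (φ y)) :
    (y ∉ S.deg2 j → M.rot (M.inv (Q.b x)) = Q.b y) ∧
      (y ∈ S.deg2 j → M.rot (M.inv (Q.b x)) = Q.t y) := by
  have hb := Q.isBoundary_b x hx
  rw [Q.mem_deg2_iff hy, t]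
  -- The dart arriving at `y`, reversed, has a face of `P` on its left, so it is not `b y`. If it is
  -- `rot (b y)`, the walk turns into the third edge, which has the hole on both sides; if it is the
  -- third dart, the walk goes straight on to `b y`.
  rcases M.eq_of_tail_eq (Q.b y) (M.inv (Q.b x)) ((Q.tail_b y hy).trans (Q.head_b hx h).symm)
    with h | h | h
  · exact absurd (h ▸ hb.2) (Q.isBoundary_b y hy).1
  · rw [h]
    refine ⟨fun h' => absurd ?_ hb.1, fun _ => rfl⟩
    have h2 := M.face_rot_inv (Q.b x)
    rw [h] at h2
    rw [← h2]
    simpa using h'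
  · rw [h]
    refine ⟨fun _ => M.rot_rot_rot _, fun h' => absurd (h ▸ hb.2) h'⟩

theorem mem_perimeter {u : S.deg2 j} {x : S.Vert} (hx : x ∈ (u : S.Vert) :: Q.Z.gap u) :
    x ∈ S.perimeter j := by
  obtain ⟨b, hb⟩ := Q.Z.split u
  rw [hb, Cycle.mem_coe_iff]
  simp only [List.mem_cons, List.mem_append] at hx ⊢
  tauto

theorem segment_unique {u v : S.deg2 j} {x : S.Vert} (hx : x ∈ (u : S.Vert) :: Q.Z.gap u)
    (hx' : x ∈ (v : S.Vert) :: Q.Z.gap v) : u = v := by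
  rcases List.mem_cons.1 hx with rfl | hx <;> rcases List.mem_cons.1 hx' with h | hx'
  · exact Subtype.ext h
  · exact absurd u.2 (Q.Z.not_mem_deg2 v _ hx')
  · exact absurd (h ▸ v.2) (Q.Z.not_mem_deg2 u _ hx)
  · exact Q.Z.eq_of_mem u v x hx hx'

/-- Being consecutive on the perimeter. -/
def Next (S : HoledComplex.{u} k) (φ : S.Vert → V) (M : CubicMap V F D) (P : Set F) (j : Fin k)
    (x y : S.Vert) : Prop :=
  x ∈ S.perimeter j ∧ y ∈ S.perimeter j ∧ M.BoundaryRel P (φ x) (φ y)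

theorem segment_chain (u : S.deg2 j) :
    List.IsChain (Next S φ M P j) ((u : S.Vert) :: (Q.Z.gap u ++ [(Q.Z.N u : S.Vert)])) := by
  have h : (S.perimeter j).Chain (Next S φ M P j) :=
    (Q.R.chain j).imp_of_mem fun a ha b hb h => ⟨ha, hb, h⟩
  obtain ⟨b, hb⟩ := Q.Z.split u
  rw [hb, Cycle.chain_coe_cons] at h
  have h' : List.IsChain (Next S φ M P j)
      (((u : S.Vert) :: (Q.Z.gap u ++ [(Q.Z.N u : S.Vert)])) ++ (b ++ [(u : S.Vert)])) := by
    simpa using h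
  exact (List.isChain_append.1 h').1

theorem next_functional (Q : M.PerimeterData P S φ j) (a b c : S.Vert) (h : Next S φ M P j a b) (h' : Next S φ M P j a c) :
    b = c := Q.R.inj (BoundaryRel.functional _ _ _ h.2.2 h'.2.2)

theorem exists_next (Q : M.PerimeterData P S φ j) {x : S.Vert} (hx : x ∈ S.perimeter j) : ∃ y, Next S φ M P j x y := by
  obtain ⟨y, hy, h⟩ := Cycle.exists_rel_of_chain (Q.R.chain j) hx
  exact ⟨y, hx, hy, h⟩

theorem exists_prev (Q : M.PerimeterData P S φ j) {y : S.Vert} (hy : y ∈ S.perimeter j) : ∃ x, Next S φ M P j x y := by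
  obtain ⟨x, hx, h⟩ := Cycle.exists_rel_of_chain' (Q.R.chain j) hy
  exact ⟨x, hx, hy, h⟩

theorem next_segment {u : S.deg2 j} {x y : S.Vert} (hx : x ∈ (u : S.Vert) :: Q.Z.gap u)
    (h : Next S φ M P j x y) : y ∈ Q.Z.gap u ∨ y = Q.Z.N u :=
  List.mem_tail_of_isChain_functional Q.next_functional (Q.segment_chain u) hx h

/-- At a vertex that is not of degree 2 the facial walk of the hole stays on the perimeter, and at
the next degree-2 vertex it turns into the hole. So a segment followed by its `t` is a stretch of a
single facial walk, and all its darts have the same face on the left. -/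
theorem isChain_map_b {v : S.Vert} (hv : v ∈ S.deg2 j) (l : List S.Vert) (x : S.Vert)
    (h : List.IsChain (Next S φ M P j) (x :: (l ++ [v]))) (hl : ∀ z ∈ l, z ∉ S.deg2 j) :
    List.IsChain (fun d e => e = M.rot (M.inv d) ∧ M.IsBoundary P d)
      ((x :: l).map Q.b ++ [Q.t v]) := by
  induction l generalizing x with
  | nil =>
    simp only [List.nil_append, List.isChain_cons_cons] at h
    simpa using ⟨((Q.rot_inv_b h.1.1 h.1.2.1 h.1.2.2).2 hv).symm, Q.isBoundary_b x h.1.1⟩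
  | cons z l ih =>
    simp only [List.cons_append, List.isChain_cons_cons] at h
    have := ih z h.2 fun y hy => hl y (by simp [hy])
    simp only [List.map_cons, List.cons_append, List.isChain_cons_cons] at this ⊢
    exact ⟨⟨((Q.rot_inv_b h.1.1 h.1.2.1 h.1.2.2).1 (hl z (by simp))).symm,
      Q.isBoundary_b x h.1.1⟩, this⟩

theorem isChain_segment (u : S.deg2 j) :
    List.IsChain (fun d e => e = M.rot (M.inv d) ∧ M.IsBoundary P d)
    (((u : S.Vert) :: Q.Z.gap u).map Q.b ++ [Q.t (Q.Z.N u)]) :=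
  Q.isChain_map_b (Q.Z.N u).2 _ _ (Q.segment_chain u) (Q.Z.not_mem_deg2 u)

theorem face_b {u : S.deg2 j} {x : S.Vert} (hx : x ∈ (u : S.Vert) :: Q.Z.gap u) :
    M.face (Q.b x) = M.face (Q.t (Q.Z.N u)) := by
  refine List.IsChain.backwards_concat_induction
    (fun d => M.face d = M.face (Q.t (Q.Z.N u))) _ (Q.isChain_segment u) ?_ rfl _
    (List.mem_map_of_mem hx)
  rintro d e ⟨rfl, -⟩ h
  rwa [M.face_rot_inv] at h

theorem mk_eq (u : S.deg2 j) :
    Quot.mk (fun u v => ∃ d, M.tail d = u ∧ M.tail (M.inv d) = v) (φ u) =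
      Quot.mk _ (φ (Q.Z.N u)) := by
  refine List.IsChain.backwards_concat_induction (b := (Q.Z.N u : S.Vert))
    (fun x => Quot.mk (fun u v => ∃ d, M.tail d = u ∧ M.tail (M.inv d) = v) (φ x) =
      Quot.mk _ (φ (Q.Z.N u))) ((u : S.Vert) :: Q.Z.gap u) (Q.segment_chain u) ?_ rfl _
      List.mem_cons_self
  rintro x y ⟨-, -, d, h1, h2, -⟩ h
  rw [← h]
  exact Quot.sound ⟨d, h1, h2⟩

/-- The dart `d` is on the old part of the boundary of the new face with label `u`. -/
def OnAnnulus (d : D) (u : S.deg2 j) : Prop :=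
  (∃ x ∈ (u : S.Vert) :: Q.Z.gap u, d = Q.b x) ∨ d = Q.t (Q.Z.N u)

theorem t_injective {u v : S.deg2 j} (h : Q.t u = Q.t v) : u = v := by
  refine Subtype.ext (Q.R.inj ?_)
  rw [← Q.tail_t u.2.1, h, Q.tail_t v.2.1]

/-- The segments partition the perimeter and `N` is injective; hence the choice in `lab` is no
choice. -/
theorem OnAnnulus.unique {d : D} {u v : S.deg2 j} (h : Q.OnAnnulus d u) (h' : Q.OnAnnulus d v) :
    u = v := by
  rcases h with ⟨x, hx, rfl⟩ | rfl <;> rcases h' with ⟨y, hy, h⟩ | h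
  · obtain rfl := Q.b_injective (Q.mem_perimeter hx) (Q.mem_perimeter hy) h
    exact Q.segment_unique hx hy
  · exact absurd h (Q.b_ne_t (Q.mem_perimeter hx) (Q.Z.N v).2.1)
  · exact absurd h.symm (Q.b_ne_t (Q.mem_perimeter hy) (Q.Z.N u).2.1)
  · exact Q.Z.N.injective (Q.t_injective h)

theorem onAnnulus_cases {d : D} {u : S.deg2 j} (h : Q.OnAnnulus d u) :
    (∃ x ∈ S.perimeter j, d = Q.b x) ∨ ∃ v : S.deg2 j, d = Q.t v := by
  rcases h with ⟨x, hx, rfl⟩ | rfl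
  · exact Or.inl ⟨x, Q.mem_perimeter hx, rfl⟩
  · exact Or.inr ⟨_, rfl⟩

theorem eq_b {d : D} {x : S.Vert} (hx : x ∈ S.perimeter j) (hd : M.IsBoundary P d)
    (h : M.tail d = φ x) : d = Q.b x :=
  hd.eq_of_tail_eq (Q.isBoundary_b x hx) (h.trans (Q.tail_b x hx).symm)

theorem eq_b_of_head {d : D} {y : S.Vert} (hy : y ∈ S.perimeter j) (hd : M.IsBoundary P d)
    (h : M.tail (M.inv d) = φ y) : ∃ x ∈ S.perimeter j, d = Q.b x := by
  obtain ⟨x, hx, -, hxy⟩ := Q.exists_prev hy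
  exact ⟨x, hx, hd.eq_of_head_eq (Q.isBoundary_b x hx) (h.trans (Q.head_b hx hxy).symm)⟩

/-- The dart before one of the darts at the perimeter, unless it enters the perimeter from the
hole. -/
theorem eq_b_of_rot_inv {d : D} {u : S.deg2 j} (h : Q.OnAnnulus (M.rot (M.inv d)) u)
    (ht : ∀ w : S.deg2 j, M.inv d ≠ Q.t w) : ∃ x ∈ S.perimeter j, d = Q.b x := by
  have h1 : M.inv d = M.rot (M.rot (M.rot (M.inv d))) := (M.rot_rot_rot _).symm
  have h2 := M.face_rot_inv d
  have h3 := M.tail_rot (M.inv d)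
  rcases Q.onAnnulus_cases h with ⟨y, hy, h⟩ | ⟨v, h⟩ <;> rw [h] at h1 h2 h3
  · refine Q.eq_b_of_head hy ⟨h2 ▸ (Q.isBoundary_b y hy).1, ?_⟩ (by rw [← h3, Q.tail_b y hy])
    rw [h1]
    by_contra hf
    exact ht ⟨y, (Q.mem_deg2_iff hy).2 hf⟩ h1
  · refine Q.eq_b_of_head v.2.1 ⟨h2 ▸ (Q.mem_deg2_iff v.2.1).1 v.2, ?_⟩
      (by rw [← h3, Q.tail_t v.2.1])
    rw [h1, Q.rot_t, M.face_rot]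
    exact (Q.isBoundary_b _ v.2.1).2

theorem onAnnulus_b {x : S.Vert} {u : S.deg2 j} (h : Q.OnAnnulus (Q.b x) u)
    (hx : x ∈ S.perimeter j) : x ∈ (u : S.Vert) :: Q.Z.gap u := by
  rcases h with ⟨y, hy, h⟩ | h
  · rwa [Q.b_injective hx (Q.mem_perimeter hy) h]
  · exact absurd h (Q.b_ne_t hx (Q.Z.N u).2.1)

theorem onAnnulus_rot_inv_b {x : S.Vert} {u : S.deg2 j} (hx : x ∈ (u : S.Vert) :: Q.Z.gap u) :
    Q.OnAnnulus (M.rot (M.inv (Q.b x))) u := by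
  obtain ⟨y, hy⟩ := Q.exists_next (Q.mem_perimeter hx)
  have h := Q.rot_inv_b hy.1 hy.2.1 hy.2.2
  rcases Q.next_segment hx hy with hy' | rfl
  · exact Or.inl ⟨y, by simp [hy'], h.1 (Q.Z.not_mem_deg2 u y hy')⟩
  · exact Or.inr (h.2 (Q.Z.N u).2)

open Classical in
/-- The new face on the left of an old dart, if there is one. -/
noncomputable def lab (d : D) : Option (S.deg2 j) :=
  if h : ∃ u, Q.OnAnnulus d u then some h.choose else none

theorem lab_eq_some_iff {d : D} {u : S.deg2 j} : Q.lab d = some u ↔ Q.OnAnnulus d u := by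
  rw [lab]
  split_ifs with h
  · rw [Option.some_inj]
    exact ⟨fun h' => h' ▸ h.choose_spec, fun h' => OnAnnulus.unique Q h.choose_spec h'⟩
  · simp only [false_iff]
    exact fun h' => h ⟨u, h'⟩

/-- The data for the insertion of a ring. -/
noncomputable def annulusData : M.AnnulusData P (S.deg2 j) where
  N := Q.Z.N
  N_ne := Q.Z.N_ne
  t u := Q.t u
  tail_t_inj u v h := by
    rw [Q.tail_t u.2.1, Q.tail_t v.2.1] at h
    exact Subtype.ext (Q.R.inj h)
  lab := Q.lab
  lab_t u := Q.lab_eq_some_iff.2 (Or.inr rfl)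
  lab_rot_t u := by
    rw [Q.rot_t]
    exact Q.lab_eq_some_iff.2 (Or.inl ⟨u, by simp, rfl⟩)
  face_not_mem d u h := by
    rcases Q.onAnnulus_cases (Q.lab_eq_some_iff.1 h) with ⟨x, hx, rfl⟩ | ⟨v, rfl⟩
    · exact (Q.isBoundary_b x hx).1
    · exact (Q.mem_deg2_iff v.2.1).1 v.2
  boundary_or d u h := by
    rcases Q.onAnnulus_cases (Q.lab_eq_some_iff.1 h) with ⟨x, hx, rfl⟩ | ⟨v, rfl⟩
    · exact Or.inl (Q.isBoundary_b x hx).2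
    · exact Or.inr ⟨v, rfl⟩
  face_inv_t u := Q.face_inv_t u.2.1
  face_inv_rot_t u := by
    rw [Q.rot_t]
    exact (Q.isBoundary_b _ u.2.1).2
  face_eq d u h := by
    rcases Q.lab_eq_some_iff.1 h with ⟨x, hx, rfl⟩ | rfl
    · exact Q.face_b hx
    · rfl
  lab_rot_inv d h h' := by
    -- Away from the cut edges labels spread in both directions along a facial walk: a labelled dart
    -- is preceded by a perimeter dart, which lies in exactly one segment, and a labelled dart other
    -- than a `t` is a perimeter dart, whose successor stays on the same segment or is its final
    -- `t`.
    ext u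
    rw [Q.lab_eq_some_iff, Q.lab_eq_some_iff]
    constructor
    · intro hu
      obtain ⟨x, hx, rfl⟩ := Q.eq_b_of_rot_inv hu h'
      obtain ⟨v, hv⟩ := Q.Z.cover x hx
      obtain rfl := OnAnnulus.unique Q hu (Q.onAnnulus_rot_inv_b hv)
      exact Or.inl ⟨x, hv, rfl⟩
    · intro hu
      rcases Q.onAnnulus_cases hu with ⟨x, hx, rfl⟩ | ⟨v, rfl⟩
      · exact Q.onAnnulus_rot_inv_b (Q.onAnnulus_b hu hx)
      · exact absurd rfl (h v)
  lab_rot_inv_t u h := by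
    rcases hl : Q.lab (M.rot (M.inv (Q.t u))) with - | v
    · rfl
    · obtain ⟨x, hx, h'⟩ := Q.eq_b_of_rot_inv (Q.lab_eq_some_iff.1 hl) h
      exact absurd h'.symm (Q.b_ne_t hx u.2.1)
  conn u := by
    rw [Q.tail_t u.2.1, Q.tail_t (Q.Z.N u).2.1]
    exact Q.mk_eq u

end PerimeterData
end CubicMap

/-! ### The map with the ring realises the altan: skeleton, faces, perimeters. -/

theorem List.isChain_infix_of {α : Type*} (l : List α) :
    List.IsChain (fun x y => ∃ p q, l = p ++ x :: y :: q) l := by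
  suffices H : ∀ l' p : List α, l = p ++ l' →
      List.IsChain (fun x y => ∃ p q, l = p ++ x :: y :: q) l' from H l [] rfl
  intro l'
  induction l' with
  | nil => simp
  | cons x l' ih =>
    intro p hp
    cases l' with
    | nil => simp
    | cons y l' =>
      exact List.isChain_cons_cons.2 ⟨⟨p, l', hp⟩, ih (p ++ [x]) (by simpa using hp)⟩

/-- This passes from the chain condition of perimeters to statements about representatives, as in
`newPerimeter_eq_iff`. A cycle with one entry is excluded because its entry follows itself in the
chain but in no representative. -/
theorem Cycle.chain_consecutive {α : Type*} {c : Cycle α}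
    (hc : ∃ a b l, c = ((a :: b :: l : List α) : Cycle α)) :
    c.Chain fun x y => ∃ l, c = ((x :: y :: l : List α) : Cycle α) := by
  obtain ⟨a, b, l, rfl⟩ := hc
  rw [Cycle.chain_coe_cons]
  refine (List.isChain_infix_of (a :: ((b :: l) ++ [a]))).imp ?_
  rintro x y ⟨p, q, h⟩
  -- An empty `q` means that the pair is the closing one, formed by the last entry and `a`.
  rcases List.eq_nil_or_concat q with rfl | ⟨q, z, rfl⟩
  · have h' : (a :: b :: l) ++ [a] = (p ++ [x]) ++ [y] := by simpa using h
    obtain ⟨h1, h2⟩ := List.append_inj' h' rfl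
    obtain rfl : a = y := by simpa using h2
    cases p with
    | nil => simp at h1
    | cons w p =>
      simp only [List.cons_append, List.cons.injEq] at h1
      obtain ⟨rfl, h1⟩ := h1
      refine ⟨p, ?_⟩
      rw [h1]
      exact (Cycle.coe_cons_eq_coe_append (a :: p) x).symm
  · have h' : (a :: b :: l) ++ [a] = (p ++ x :: y :: q) ++ [z] := by simpa using h
    obtain ⟨h1, -⟩ := List.append_inj' h' rfl
    refine ⟨q ++ p, ?_⟩
    rw [h1]
    exact Cycle.coe_eq_coe.2 List.isRotated_append

namespace CubicMap

variable {V F D : Type u} {M : CubicMap V F D} {P : Set F} {k : ℕ}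

open AltanDart AnnulusData

namespace AnnulusData
variable {U : Type u} (A : M.AnnulusData P U)

theorem inv'_old_of_or {d : D} (h : M.face d ∈ P ∨ M.face (M.inv d) ∈ P) :
    A.inv' (old d) = old (M.inv d) := by
  rcases h with h | h
  · exact A.inv'_old_of_mem h
  · refine A.inv'_old (fun u hu => A.face_inv_t u (hu ▸ h)) (fun u hu => A.face_t_not_mem u (hu ▸ h))

theorem face_mem_or {d : D} (hd : ∀ u, d ≠ A.t u) (h : A.face' (old d) ∈ patch P U) :
    M.face d ∈ P ∨ M.face (M.inv d) ∈ P := by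
  rcases hl : A.lab d with - | u
  · rw [A.face'_old hl] at h
    exact Or.inl h
  · exact Or.inr ((A.boundary_or d u hl).resolve_right fun ⟨v, hv⟩ => hd v hv)

theorem face'_old_mem {d : D} (h : M.face d ∈ P) : A.face' (old d) ∈ patch P U := by
  rw [A.face'_old_of_mem h]
  exact h

theorem face'_o_not_mem (u : U) : A.face' (o u) ∉ patch P U := A.face_t_not_mem u

/-- Together with `face'_o_not_mem`: the outer piece at u'' has faces outside the patch on both
sides. So it is neither in the skeleton nor on a perimeter. -/
theorem face'_inv'_o_not_mem (u : U) : A.face' (A.inv' (o u)) ∉ patch P U := by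
  by_cases hw : ∃ w, M.inv (A.t u) = A.t w
  · obtain ⟨w, hw⟩ := hw
    rw [A.inv'_o_t hw]
    exact A.face_t_not_mem w
  · have hw : ∀ w, M.inv (A.t u) ≠ A.t w := by simpa using hw
    rw [A.inv'_o hw, A.face'_old (A.lab_inv_t_eq_none hw)]
    exact A.face_inv_t u

theorem face_t_mem (u : U) : A.face' (old (A.t u)) ∈ patch P U := by
  rw [A.face'_old_some (A.lab_t' u)]
  exact inr_mem_patch _

/-- The boundary darts after the insertion of the ring. -/
theorem isBoundary_old_iff (d : D) : A.altan.IsBoundary (patch P U) (old d) ↔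
    M.IsBoundary P d ∧ A.lab d = none := by
  change A.face' (old d) ∉ _ ∧ A.face' (A.inv' (old d)) ∈ _ ↔ _
  constructor
  · rintro ⟨h1, h2⟩
    have hl : A.lab d = none := by
      rcases hl : A.lab d with - | u
      · rfl
      · rw [A.face'_old_some hl] at h1
        exact absurd (inr_mem_patch u) h1
    rw [A.face'_old hl] at h1
    refine ⟨⟨h1, ?_⟩, hl⟩
    rcases A.dart_cases d with ⟨u, rfl⟩ | ⟨u, hu, rfl⟩ | ⟨hd, hd'⟩
    · rw [A.lab_t'] at hl
      simp at hl
    · rw [A.inv'_inv_t hu (M.inv_inv _)] at h2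
      exact absurd h2 (A.face'_o_not_mem u)
    · rw [A.inv'_old hd hd'] at h2
      rcases A.face_mem_or hd' h2 with h | h
      · exact h
      · rw [M.inv_inv] at h
        exact absurd h h1
  · rintro ⟨⟨h1, h2⟩, hl⟩
    rw [A.face'_old hl, A.inv'_old_of_or (Or.inr h2)]
    exact ⟨h1, A.face'_old_mem h2⟩

theorem not_isBoundary_of_mem {x : AltanDart D U} (h : A.face' x ∈ patch P U) :
    ¬ A.altan.IsBoundary (patch P U) x := fun h' => h'.1 h

/-- The pairs of vertices joined by a boundary dart after the insertion of the ring. -/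
theorem boundaryRel_iff (x y : V ⊕ U × Bool) : A.altan.BoundaryRel (patch P U) x y ↔
    (∃ d, M.IsBoundary P d ∧ A.lab d = none ∧ x = Sum.inl (M.tail d) ∧
      y = Sum.inl (M.tail (M.inv d))) ∨
    (∃ u, x = Sum.inr (u, false) ∧ y = Sum.inr (u, true)) ∨
      ∃ u, x = Sum.inr (u, true) ∧ y = Sum.inr (A.N u, false) := by
  constructor
  · rintro ⟨e, rfl, rfl, h⟩
    cases e with
    | old d =>
      have h' := (A.isBoundary_old_iff d).1 h
      refine Or.inl ⟨d, h'.1, h'.2, rfl, ?_⟩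
      change A.tail' (A.inv' (old d)) = _
      rw [A.inv'_old_of_or (Or.inr h'.1.2)]
      rfl
    | p u => exact Or.inr (Or.inl ⟨u, rfl, rfl⟩)
    | n u => exact Or.inr (Or.inr ⟨u, rfl, rfl⟩)
    | o u => exact absurd h.2 (A.face'_inv'_o_not_mem u)
    | s u => exact absurd h (A.not_isBoundary_of_mem (inr_mem_patch u))
    | q u => exact absurd h (A.not_isBoundary_of_mem (inr_mem_patch _))
    | m u => exact absurd h (A.not_isBoundary_of_mem (inr_mem_patch u))
  · rintro (⟨d, h, hl, rfl, rfl⟩ | ⟨u, rfl, rfl⟩ | ⟨u, rfl, rfl⟩)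
    · refine ⟨old d, rfl, ?_, (A.isBoundary_old_iff d).2 ⟨h, hl⟩⟩
      change A.tail' (A.inv' (old d)) = _
      rw [A.inv'_old_of_or (Or.inr h.2)]
      rfl
    · exact ⟨p u, rfl, rfl, A.face_t_not_mem u, inr_mem_patch u⟩
    · refine ⟨n u, rfl, rfl, ?_, inr_mem_patch _⟩
      change Sum.inl (M.face (M.rot (A.t u))) ∉ patch P U
      rw [A.face_rot_t]
      exact A.face_t_not_mem _

/-- The boundary walks of the old faces in `P` do not change. -/
theorem isFacialWalk_inl {f : F} (hf : f ∈ P) (c : Cycle (V ⊕ U × Bool)) :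
    A.altan.IsFacialWalk (Sum.inl f) c ↔ ∃ c₀, M.IsFacialWalk f c₀ ∧ c = c₀.map Sum.inl := by
  -- Every dart leaving a ring vertex has a new face or a face outside `P` on its left. So a walk
  -- around a face of `P` uses old darts only, and on these the reversal is the old one.
  have hold : ∀ x : AltanDart D U, A.face' x = Sum.inl f → ∃ d, M.face d = f ∧ x = old d := by
    intro x hx
    cases x with
    | old d =>
      refine ⟨d, ?_, rfl⟩
      rcases hl : A.lab d with - | u
      · rw [A.face'_old hl] at hx
        exact Sum.inl.inj hx
      · rw [A.face'_old_some hl] at hx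
        cases hx
    | p u => exact absurd (Sum.inl.inj hx ▸ hf) (A.face_t_not_mem u)
    | n u =>
      have := Sum.inl.inj hx
      rw [A.face_rot_t] at this
      exact absurd (this ▸ hf) (A.face_t_not_mem _)
    | o u => exact absurd (Sum.inl.inj hx ▸ hf) (A.face_t_not_mem u)
    | s u => cases hx
    | q u => cases hx
    | m u => cases hx
  have hinj : Function.Injective (old : D → AltanDart D U) := fun _ _ h => AltanDart.old.inj h
  constructor
  · rintro ⟨w, h1, h2, h3, h4, rfl⟩
    obtain ⟨w, rfl⟩ := Cycle.exists_map_eq_of_forall_mem_range (f := (old : D → AltanDart D U))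
      (c := w) (fun x hx => by obtain ⟨d, -, rfl⟩ := hold x (h4 x hx); exact ⟨d, rfl⟩)
    have h5 : ∀ d ∈ w, M.face d = f := by
      intro d hd
      obtain ⟨e, he, h⟩ := hold (old d) (h4 (old d) (Cycle.mem_map.2 ⟨d, hd, rfl⟩))
      rwa [hinj h]
    refine ⟨w.map M.tail, ⟨w, fun h => h1 (by rw [h]; rfl), h2.of_map, ?_, h5, rfl⟩, ?_⟩
    · refine Cycle.Chain.imp_of_mem ((Cycle.chain_map _).1 h3) fun d hd e he h => ?_
      have h : old e = A.rot' (A.inv' (old d)) := h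
      rw [A.inv'_old_of_mem (h5 d hd ▸ hf)] at h
      exact hinj h
    · rw [Cycle.map_map, Cycle.map_map]
      rfl
  · rintro ⟨_, ⟨w, h1, h2, h3, h4, rfl⟩, rfl⟩
    refine ⟨w.map old, by simpa using h1, (Cycle.nodup_map_iff hinj).2 h2, ?_, ?_, ?_⟩
    · refine (Cycle.chain_map _).2 (h3.imp_of_mem ?_)
      rintro d hd _ - rfl
      change _ = A.rot' (A.inv' (old d))
      rw [A.inv'_old_of_mem (h4 d hd ▸ hf)]
      rfl
    · intro x hx
      obtain ⟨d, hd, rfl⟩ := Cycle.mem_map.1 hx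
      rw [← h4 d hd]
      exact A.face'_old_of_mem (h4 d hd ▸ hf)
    · rw [Cycle.map_map, Cycle.map_map]
      rfl

end AnnulusData

namespace PerimeterData

variable {S : HoledComplex.{u} k} {φ : S.Vert → V} {j : Fin k}

/-- The embedding of the vertices of the altan. -/
def altanEmb (φ : S.Vert → V) (j : Fin k) : S.AltanVert j → V ⊕ S.deg2 j × Bool := Sum.map φ id

theorem altanEmb_injective (h : Function.Injective φ) : Function.Injective (altanEmb φ j) :=
  Sum.map_injective.2 ⟨h, Function.injective_id⟩

variable (Q : M.PerimeterData P S φ j)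

theorem exists_tail_eq_of_lab {d : D} {u : S.deg2 j} (h : Q.annulusData.lab d = some u) :
    ∃ x ∈ S.perimeter j, M.tail d = φ x := by
  rcases Q.onAnnulus_cases (Q.lab_eq_some_iff.1 h) with ⟨x, hx, rfl⟩ | ⟨v, rfl⟩
  · exact ⟨x, hx, Q.tail_b x hx⟩
  · exact ⟨v, v.2.1, Q.tail_t v.2.1⟩

theorem altan_vert (v : V ⊕ S.deg2 j × Bool) : v ∈ Set.range (altanEmb φ j) ↔
    ∃ d, Q.annulusData.tail' d = v ∧ Q.annulusData.face' d ∈ patch P (S.deg2 j) := by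
  constructor
  · rintro ⟨x | ⟨u, b | b⟩, rfl⟩
    · obtain ⟨d, hd, hd'⟩ := (Q.R.vert (φ x)).1 ⟨x, rfl⟩
      exact ⟨old d, congrArg Sum.inl hd, Q.annulusData.face'_old_mem hd'⟩
    · exact ⟨s u, rfl, inr_mem_patch _⟩
    · exact ⟨m u, rfl, inr_mem_patch _⟩
  · rintro ⟨d, rfl, hd⟩
    cases d with
    | old d =>
      rcases hl : Q.annulusData.lab d with - | u
      · rw [Q.annulusData.face'_old hl] at hd
        obtain ⟨x, hx⟩ := (Q.R.vert (M.tail d)).2 ⟨d, rfl, hd⟩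
        exact ⟨Sum.inl x, congrArg Sum.inl hx⟩
      · obtain ⟨x, -, hx⟩ := Q.exists_tail_eq_of_lab hl
        exact ⟨Sum.inl x, congrArg Sum.inl hx.symm⟩
    | _ => exact ⟨Sum.inr _, rfl⟩

/-- The skeleton after the insertion of the ring. -/
def SkelAdj (x y : V ⊕ S.deg2 j × Bool) : Prop :=
  ∃ d, Q.annulusData.tail' d = x ∧ Q.annulusData.tail' (Q.annulusData.inv' d) = y ∧
    (Q.annulusData.face' d ∈ patch P (S.deg2 j) ∨
      Q.annulusData.face' (Q.annulusData.inv' d) ∈ patch P (S.deg2 j))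

theorem skelAdj_comm (x y : V ⊕ S.deg2 j × Bool) : Q.SkelAdj x y ↔ Q.SkelAdj y x := by
  have : ∀ x y, Q.SkelAdj x y → Q.SkelAdj y x := by
    rintro x y ⟨d, h1, h2, h3⟩
    exact ⟨Q.annulusData.inv' d, h2, by rw [Q.annulusData.inv'_inv', h1],
      by rw [Q.annulusData.inv'_inv']; exact h3.symm⟩
  exact ⟨this x y, this y x⟩

theorem skelAdj_inl_inl (x y : S.Vert) :
    Q.SkelAdj (Sum.inl (φ x)) (Sum.inl (φ y)) ↔ S.graph.Adj x y := by
  set A := Q.annulusData with hA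
  rw [Q.R.adj]
  constructor
  · rintro ⟨e, h1, h2, h3⟩
    rw [← hA] at h1 h2 h3
    cases e with
    | old d =>
      rcases A.dart_cases d with ⟨u, rfl⟩ | ⟨u, hu, rfl⟩ | ⟨hd, hd'⟩
      · rw [A.inv'_t] at h2
        cases h2
      · rw [A.inv'_inv_t hu (M.inv_inv _)] at h2
        cases h2
      · rw [A.inv'_old hd hd'] at h2 h3
        refine ⟨d, Sum.inl.inj h1, Sum.inl.inj h2, ?_⟩
        rcases h3 with h3 | h3
        · exact A.face_mem_or hd h3
        · have := A.face_mem_or hd' h3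
          rw [M.inv_inv] at this
          exact this.symm
    | _ => cases h1
  · rintro ⟨d, h1, h2, h3⟩
    refine ⟨old d, congrArg Sum.inl h1, ?_, ?_⟩
    · rw [← hA, A.inv'_old_of_or h3]
      exact congrArg Sum.inl h2
    · rw [← hA, A.inv'_old_of_or h3]
      exact h3.imp A.face'_old_mem A.face'_old_mem

theorem skelAdj_inl_inr (x : S.Vert) (v : S.deg2 j) (b : Bool) :
    Q.SkelAdj (Sum.inl (φ x)) (Sum.inr (v, b)) ↔ x = v ∧ b = false := by
  set A := Q.annulusData with hA
  constructor
  · rintro ⟨e, h1, h2, h3⟩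
    rw [← hA] at h1 h2 h3
    cases e with
    | old d =>
      rcases A.dart_cases d with ⟨u, rfl⟩ | ⟨u, hu, rfl⟩ | ⟨hd, hd'⟩
      · rw [A.inv'_t] at h2
        obtain ⟨rfl, rfl⟩ := Prod.ext_iff.1 (Sum.inr.inj h2)
        exact ⟨Q.R.inj ((Sum.inl.inj h1).symm.trans (Q.tail_t u.2.1)), rfl⟩
      · rw [A.inv'_inv_t hu (M.inv_inv _)] at h3
        rcases h3 with h3 | h3
        · rw [A.face'_old (A.lab_inv_t_eq_none hu)] at h3
          exact absurd h3 (A.face_inv_t u)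
        · exact absurd h3 (A.face'_o_not_mem u)
      · rw [A.inv'_old hd hd'] at h2
        cases h2
    | _ => cases h1
  · rintro ⟨rfl, rfl⟩
    refine ⟨old (Q.t v), congrArg Sum.inl (Q.tail_t v.2.1), ?_, Or.inl (A.face_t_mem v)⟩
    rw [← hA]
    exact A.tail'_inv'_t v

theorem skelAdj_inr_inr (u v : S.deg2 j) (b b' : Bool) :
    Q.SkelAdj (Sum.inr (u, b)) (Sum.inr (v, b')) ↔
      (b = false ∧ b' = true ∧ (u = v ∨ u = Q.Z.N v)) ∨
        (b = true ∧ b' = false ∧ (v = u ∨ v = Q.Z.N u)) := by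
  set A := Q.annulusData with hA
  constructor
  · rintro ⟨e, h1, h2, h3⟩
    rw [← hA] at h1 h2 h3
    cases e with
    | old d => cases h1
    | s w => cases h2
    | q w =>
      cases h1; cases h2
      exact Or.inl ⟨rfl, rfl, Or.inr (A.N.apply_symm_apply _).symm⟩
    | p w => cases h1; cases h2; exact Or.inl ⟨rfl, rfl, Or.inl rfl⟩
    | o w =>
      exact absurd h3 (not_or.2 ⟨A.face'_o_not_mem w, A.face'_inv'_o_not_mem w⟩)
    | n w => cases h1; cases h2; exact Or.inr ⟨rfl, rfl, Or.inr rfl⟩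
    | m w => cases h1; cases h2; exact Or.inr ⟨rfl, rfl, Or.inl rfl⟩
  · rintro (⟨rfl, rfl, rfl | rfl⟩ | ⟨rfl, rfl, rfl | rfl⟩)
    · exact ⟨p u, rfl, rfl, Or.inr (inr_mem_patch _)⟩
    · exact (Q.skelAdj_comm _ _).1 ⟨n v, rfl, rfl, Or.inr (inr_mem_patch _)⟩
    · exact ⟨m v, rfl, rfl, Or.inl (inr_mem_patch _)⟩
    · exact ⟨n u, rfl, rfl, Or.inr (inr_mem_patch _)⟩

theorem altan_adj (x y : S.AltanVert j) :
    (S.altanGraph j).Adj x y ↔ Q.SkelAdj (altanEmb φ j x) (altanEmb φ j y) := by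
  rcases x with x | ⟨u, b⟩ <;> rcases y with y | ⟨v, b'⟩
  · rw [Q.Z.adj_inl_inl]
    exact (Q.skelAdj_inl_inl x y).symm
  · rw [Q.Z.adj_inl_inr]
    exact (Q.skelAdj_inl_inr x v b').symm
  · rw [SimpleGraph.adj_comm, Q.Z.adj_inl_inr]
    exact ((Q.skelAdj_comm _ _).trans (Q.skelAdj_inl_inr y u b)).symm
  · rw [Q.Z.adj_inr_inr]
    exact (Q.skelAdj_inr_inr u v b b').symm

/-- The boundary of the new face between `u` and the next degree-2 vertex. -/
def newFace (Q : M.PerimeterData P S φ j) (u : S.deg2 j) : Cycle (S.AltanVert j) :=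
  (((Sum.inl (u : S.Vert) :: (Q.Z.gap u).map Sum.inl) ++
    [Sum.inl (Q.Z.N u : S.Vert), Sum.inr (Q.Z.N u, false), Sum.inr (u, true), Sum.inr (u, false)] :
      List (S.AltanVert j)) : Cycle (S.AltanVert j))

/-- The perimeter has no repetitions, so its representative starting at `u` is unique, and `v` must
be the first degree-2 vertex after `u`. -/
theorem mem_annulusFaces_iff (s : Set (Cycle (S.AltanVert j))) :
    s ∈ S.annulusFaces j ↔ ∃ u, s = {Q.newFace u} := by
  constructor
  · rintro ⟨u, v, a, b, h1, h2, rfl⟩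
    obtain ⟨b', hb'⟩ := Q.Z.split u
    have hn : ((u : S.Vert) :: (a ++ (v : S.Vert) :: b)).Nodup := by
      rw [← Cycle.nodup_coe_iff, ← h1]
      exact Q.R.nodup j
    obtain ⟨rfl, h, -⟩ := List.append_cons_inj_of_first (p := (· ∈ S.deg2 j))
      (Cycle.coe_cons_inj hn (h1.symm.trans hb')) h2 (Q.Z.not_mem_deg2 u) v.2 (Q.Z.N u).2
    obtain rfl := Subtype.ext h
    exact ⟨u, rfl⟩
  · rintro ⟨u, rfl⟩
    obtain ⟨b, hb⟩ := Q.Z.split u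
    exact ⟨u, Q.Z.N u, Q.Z.gap u, b, hb, Q.Z.not_mem_deg2 u, rfl⟩

/-- The darts around a new face. -/
def newFaceDarts (Q : M.PerimeterData P S φ j) (u : S.deg2 j) : List (AltanDart D (S.deg2 j)) :=
  (((u : S.Vert) :: Q.Z.gap u).map Q.b ++ [Q.t (Q.Z.N u)]).map old ++ [q (Q.Z.N u), m u, s u]

theorem newFaceDarts_nodup (u : S.deg2 j) : (Q.newFaceDarts u).Nodup := by
  have hn : ((u : S.Vert) :: Q.Z.gap u).Nodup := by
    obtain ⟨b, hb⟩ := Q.Z.split u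
    have := Q.R.nodup j
    rw [hb, Cycle.nodup_coe_iff] at this
    have h : ((u : S.Vert) :: Q.Z.gap u) <+: (u : S.Vert) :: (Q.Z.gap u ++ (Q.Z.N u : S.Vert) :: b) :=
      ⟨_, rfl⟩
    exact this.sublist h.sublist
  have h1 : (((u : S.Vert) :: Q.Z.gap u).map Q.b).Nodup :=
    hn.map_on fun x hx y hy h => Q.b_injective (Q.mem_perimeter hx) (Q.mem_perimeter hy) h
  have h2 : (((u : S.Vert) :: Q.Z.gap u).map Q.b ++ [Q.t (Q.Z.N u)]).Nodup := by
    refine List.nodup_append.2 ⟨h1, by simp, ?_⟩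
    intro d hd e he
    obtain ⟨x, hx, rfl⟩ := List.mem_map.1 hd
    rw [List.mem_singleton.1 he]
    exact Q.b_ne_t (Q.mem_perimeter hx) (Q.Z.N u).2.1
  refine List.nodup_append.2 ⟨h2.map fun _ _ h => AltanDart.old.inj h, by simp, ?_⟩
  intro d hd e he
  obtain ⟨x, -, rfl⟩ := List.mem_map.1 hd
  rintro rfl
  simp at he

theorem newFaceDarts_chain (u : S.deg2 j) : ((Q.newFaceDarts u : List _) : Cycle _).Chain
    fun d e => e = Q.annulusData.rot' (Q.annulusData.inv' d) := by
  set A := Q.annulusData with hA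
  have h1 : List.IsChain (fun d e => e = A.rot' (A.inv' d))
      ((((u : S.Vert) :: Q.Z.gap u).map Q.b ++ [Q.t (Q.Z.N u)]).map old) := by
    rw [List.isChain_map]
    refine (Q.isChain_segment u).imp ?_
    rintro d _ ⟨rfl, h⟩
    rw [A.inv'_old_of_or (Or.inr h.2)]
    rfl
  have h2 : List.IsChain (fun d e => e = A.rot' (A.inv' d))
      [q (Q.Z.N u), m u, s u, old (Q.b u)] := by
    simp only [List.isChain_cons_cons, List.isChain_singleton, and_true]
    refine ⟨?_, rfl, ?_⟩
    · change m u = m (Q.Z.N.symm (Q.Z.N u))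
      rw [Q.Z.N.symm_apply_apply]
    · change old (Q.b u) = old (M.rot (Q.t u))
      rw [Q.rot_t]
  change Cycle.Chain _ ((old (Q.b u) :: (((Q.Z.gap u).map Q.b ++ [Q.t (Q.Z.N u)]).map old ++
    [q (Q.Z.N u), m u, s u]) : List (AltanDart D (S.deg2 j))) : Cycle (AltanDart D (S.deg2 j)))
  rw [Cycle.chain_coe_cons]
  have h3 : List.IsChain (fun d e => e = A.rot' (A.inv' d))
      ((((u : S.Vert) :: Q.Z.gap u).map Q.b ++ [Q.t (Q.Z.N u)]).map old ++
        [q (Q.Z.N u), m u, s u, old (Q.b u)]) := by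
    refine List.isChain_append.2 ⟨h1, h2, ?_⟩
    intro x hx y hy
    simp only [List.map_append, List.map_cons, List.map_nil, List.getLast?_append,
      List.getLast?_singleton, Option.some_or, Option.mem_def, Option.some_inj,
      List.head?_cons] at hx hy
    subst hx hy
    change _ = A.rot' (A.inv' (old (A.t (Q.Z.N u))))
    rw [A.inv'_t]
    rfl
  simpa using h3

/-- The listed darts form one closed walk and exhaust the face. A new face thus has a single
boundary walk, as the singletons in `annulusFaces` require. -/
theorem mem_newFaceDarts_iff (u : S.deg2 j) (x : AltanDart D (S.deg2 j)) :
    x ∈ Q.newFaceDarts u ↔ Q.annulusData.face' x = Sum.inr u := by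
  set A := Q.annulusData with hA
  have hq : ∀ v, A.face' (q v) = Sum.inr (Q.Z.N.symm v) := fun v => rfl
  constructor
  · intro hx
    rcases List.mem_append.1 hx with hx | hx
    · obtain ⟨d, hd, rfl⟩ := List.mem_map.1 hx
      refine A.face'_old_some (Q.lab_eq_some_iff.2 ?_)
      rcases List.mem_append.1 hd with hd | hd
      · obtain ⟨y, hy, rfl⟩ := List.mem_map.1 hd
        exact Or.inl ⟨y, hy, rfl⟩
      · exact Or.inr (List.mem_singleton.1 hd)
    · simp only [List.mem_cons, List.not_mem_nil, or_false] at hx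
      rcases hx with rfl | rfl | rfl
      · rw [hq, Q.Z.N.symm_apply_apply]
      · rfl
      · rfl
  · intro hx
    cases x with
    | old d =>
      rcases hl : A.lab d with - | v
      · rw [A.face'_old hl] at hx
        cases hx
      · rw [A.face'_old_some hl] at hx
        cases hx
        refine List.mem_append_left _ (List.mem_map_of_mem ?_)
        rcases Q.lab_eq_some_iff.1 hl with ⟨y, hy, rfl⟩ | rfl
        · exact List.mem_append_left _ (List.mem_map_of_mem hy)
        · exact List.mem_append_right _ (by simp)
    | q v =>
      rw [hq] at hx
      obtain rfl := Sum.inr.inj hx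
      exact List.mem_append_right _ (by simp)
    | m v => cases hx; exact List.mem_append_right _ (by simp)
    | s v => cases hx; exact List.mem_append_right _ (by simp)
    | p v => cases hx
    | o v => cases hx
    | n v => cases hx

theorem newFaceDarts_map (u : S.deg2 j) : ((Q.newFaceDarts u : List _) : Cycle _).map
    Q.annulusData.tail' = (Q.newFace u).map (altanEmb φ j) := by
  have h : (((u : S.Vert) :: Q.Z.gap u).map Q.b).map M.tail =
      ((u : S.Vert) :: Q.Z.gap u).map φ := by
    rw [List.map_map]
    exact List.map_congr_left fun x hx => Q.tail_b x (Q.mem_perimeter hx)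
  have h' : (Q.newFaceDarts u).map Q.annulusData.tail' =
      ((((u : S.Vert) :: Q.Z.gap u).map Q.b).map M.tail).map Sum.inl ++
        [Sum.inl (M.tail (Q.t (Q.Z.N u))), Sum.inr (Q.Z.N u, false), Sum.inr (u, true),
          Sum.inr (u, false)] := by
    simp [newFaceDarts, AnnulusData.tail', Function.comp_def]
  rw [newFace, Cycle.map_coe, Cycle.map_coe, h', h, Q.tail_t (Q.Z.N u).2.1]
  simp [altanEmb, Function.comp_def]

theorem isFacialWalk_inr (u : S.deg2 j) (c : Cycle (S.AltanVert j)) :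
    Q.annulusData.altan.IsFacialWalk (Sum.inr u) (c.map (altanEmb φ j)) ↔ c = Q.newFace u := by
  constructor
  · rintro ⟨w, h1, h2, h3, h4, h5⟩
    obtain ⟨x, hx⟩ := Cycle.exists_mem_of_ne_nil h1
    have hw : w = ((Q.newFaceDarts u : List _) : Cycle _) :=
      Cycle.eq_of_functional (by rintro a b c rfl rfl; rfl) h2
        (Cycle.nodup_coe_iff.2 (Q.newFaceDarts_nodup u)) h3 (Q.newFaceDarts_chain u) hx
        (Cycle.mem_coe_iff.2 ((Q.mem_newFaceDarts_iff u x).2 (h4 x hx)))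
    rw [hw] at h5
    exact Cycle.map_injective (altanEmb_injective Q.R.inj) (h5.trans (Q.newFaceDarts_map u))
  · rintro rfl
    refine ⟨((Q.newFaceDarts u : List (AltanDart D (S.deg2 j))) :
      Cycle (AltanDart D (S.deg2 j))), ?_,
      Cycle.nodup_coe_iff.2 (Q.newFaceDarts_nodup u), Q.newFaceDarts_chain u, ?_,
      (Q.newFaceDarts_map u).symm⟩
    · rw [Ne, Cycle.coe_eq_nil]
      simp [newFaceDarts]
    · intro d hd
      exact (Q.mem_newFaceDarts_iff u d).1 (Cycle.mem_coe_iff.1 hd)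

theorem altan_faces (t : Set (Cycle (S.AltanVert j))) : t ∈ (S.altanAt j).faces ↔
    ∃ f ∈ patch P (S.deg2 j),
      t = {c | Q.annulusData.altan.IsFacialWalk f (c.map (altanEmb φ j))} := by
  have hF : ∀ f ∈ P, {c | Q.annulusData.altan.IsFacialWalk (Sum.inl f) (c.map (altanEmb φ j))} =
      (fun s => Cycle.map Sum.inl '' s) {c | M.IsFacialWalk f (c.map φ)} := by
    intro f hf
    ext c
    change Q.annulusData.altan.IsFacialWalk (Sum.inl f) (c.map (altanEmb φ j)) ↔ _
    rw [Q.annulusData.isFacialWalk_inl hf]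
    constructor
    · rintro ⟨c₀, h1, h2⟩
      obtain ⟨c', rfl⟩ : ∃ c' : Cycle S.Vert, c'.map Sum.inl = c := by
        refine Cycle.exists_map_eq_of_forall_mem_range fun x hx => ?_
        have := Cycle.mem_map (f := altanEmb φ j).2 ⟨x, hx, rfl⟩
        rw [h2] at this
        obtain ⟨y, -, hy⟩ := Cycle.mem_map.1 this
        rcases x with x | x
        · exact ⟨x, rfl⟩
        · cases hy
      refine ⟨c', ?_, rfl⟩
      have : c'.map φ = c₀ := by
        refine Cycle.map_injective (Sum.inl_injective (β := S.deg2 j × Bool)) ?_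
        rw [← h2, Cycle.map_map, Cycle.map_map]
        rfl
      subst this
      exact h1
    · rintro ⟨c', h1, rfl⟩
      refine ⟨_, h1, ?_⟩
      rw [Cycle.map_map, Cycle.map_map]
      rfl
  have hU : ∀ u : S.deg2 j, {c | Q.annulusData.altan.IsFacialWalk (Sum.inr u)
      (c.map (altanEmb φ j))} = {Q.newFace u} := by
    intro u
    ext c
    exact Q.isFacialWalk_inr u c
  change t ∈ (fun s => Cycle.map Sum.inl '' s) '' S.faces ∪ S.annulusFaces j ↔ _
  rw [Set.mem_union, Q.mem_annulusFaces_iff]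
  constructor
  · rintro (⟨s, hs, rfl⟩ | ⟨u, rfl⟩)
    · obtain ⟨f, hf, rfl⟩ := (Q.R.faces s).1 hs
      exact ⟨Sum.inl f, hf, (hF f hf).symm⟩
    · exact ⟨Sum.inr u, inr_mem_patch u, (hU u).symm⟩
  · rintro ⟨f | u, hf, rfl⟩
    · exact Or.inl ⟨_, (Q.R.faces _).2 ⟨f, hf, rfl⟩, (hF f hf).symm⟩
    · exact Or.inr ⟨u, hU u⟩

/-- The boundary darts that cease to be boundary darts are exactly those of the treated perimeter.
-/
theorem lab_eq_none_iff {d : D} (hd : M.IsBoundary P d) {x : S.Vert} (hx : M.tail d = φ x) :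
    Q.annulusData.lab d = none ↔ x ∉ S.perimeter j := by
  constructor
  · intro h hxj
    obtain ⟨u, hu⟩ := Q.Z.cover x hxj
    have : Q.annulusData.lab d = some u := Q.lab_eq_some_iff.2 (Or.inl ⟨x, hu, Q.eq_b hxj hd hx⟩)
    rw [h] at this
    cases this
  · intro h
    rcases hl : Q.annulusData.lab d with - | u
    · rfl
    · obtain ⟨y, hy, hy'⟩ := Q.exists_tail_eq_of_lab hl
      exact absurd hy (Q.R.inj (hx.symm.trans hy') ▸ h)

theorem isPerimeter_newPerimeter : Q.annulusData.altan.IsPerimeter (patch P (S.deg2 j))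
    ((S.newPerimeter j).map (altanEmb φ j)) := by
  have hN : ∀ u : S.deg2 j, Sum.inr (u, false) ∈ S.newPerimeter j := fun u =>
    (Q.Z.mem_new _).2 ⟨_, rfl⟩
  refine ⟨?_, (Cycle.nodup_map_iff (altanEmb_injective Q.R.inj)).2 Q.Z.new_nodup, ?_⟩
  · intro h
    rw [Cycle.map_eq_nil] at h
    obtain ⟨x, hx⟩ := Cycle.exists_mem_of_ne_nil
      (fun h => (Q.R.isPerimeter j).1 (by rw [h]; rfl) : S.perimeter j ≠ Cycle.nil)
    obtain ⟨u, -⟩ := Q.Z.cover x hx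
    have := hN u
    rw [h] at this
    exact Cycle.notMem_nil _ this
  · rw [Cycle.chain_map]
    have h := Cycle.chain_consecutive (c := S.newPerimeter j) (by
      obtain ⟨x, hx⟩ := Cycle.exists_mem_of_ne_nil
        (fun h => (Q.R.isPerimeter j).1 (by rw [h]; rfl) : S.perimeter j ≠ Cycle.nil)
      obtain ⟨u, -⟩ := Q.Z.cover x hx
      obtain ⟨b, hb⟩ := Q.Z.new_split u
      exact ⟨_, _, _, hb⟩)
    refine h.imp fun x y hxy => ?_
    rw [Q.annulusData.boundaryRel_iff]
    rcases (Q.Z.newPerimeter_eq_iff x y).1 hxy with ⟨u, rfl, rfl⟩ | ⟨u, rfl, rfl⟩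
    · exact Or.inr (Or.inl ⟨u, rfl, rfl⟩)
    · exact Or.inr (Or.inr ⟨u, rfl, rfl⟩)

theorem perimeter_altanAt {i : Fin k} : (S.altanAt j).perimeter i =
    if i = j then S.newPerimeter j else (S.perimeter i).map Sum.inl := rfl

theorem isPerimeter_altanAt (i : Fin k) : Q.annulusData.altan.IsPerimeter (patch P (S.deg2 j))
    (((S.altanAt j).perimeter i).map (altanEmb φ j)) := by
  rw [perimeter_altanAt]
  split_ifs with h
  · exact Q.isPerimeter_newPerimeter
  · obtain ⟨h1, h2, h3⟩ := Q.R.isPerimeter i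
    have hm : ((S.perimeter i).map Sum.inl).map (altanEmb φ j) =
        ((S.perimeter i).map φ).map (Sum.inl (β := S.deg2 j × Bool)) := by
      rw [Cycle.map_map, Cycle.map_map]
      rfl
    refine hm ▸ ⟨by simpa using h1, (Cycle.nodup_map_iff Sum.inl_injective).2 h2, ?_⟩
    rw [Cycle.chain_map, Cycle.chain_map]
    refine (Q.R.chain i).imp_of_mem fun x hx y _ hxy => ?_
    obtain ⟨d, h4, h5, h6⟩ := hxy
    rw [Q.annulusData.boundaryRel_iff]
    exact Or.inl ⟨d, h6, (Q.lab_eq_none_iff h6 h4).2 (Q.R.disjoint h x hx),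
      congrArg Sum.inl h4.symm, congrArg Sum.inl h5.symm⟩

/-- No boundary dart leads from an old vertex to a ring vertex. A perimeter through an old vertex
therefore consists of old vertices and is an old perimeter other than the `j`-th; one through a ring
vertex shares that vertex with the new cycle and equals it. -/
theorem altan_perimeter (c : Cycle (S.AltanVert j)) :
    c ∈ Set.range (S.altanAt j).perimeter ↔
      Q.annulusData.altan.IsPerimeter (patch P (S.deg2 j)) (c.map (altanEmb φ j)) := by
  constructor
  · rintro ⟨i, rfl⟩
    exact Q.isPerimeter_altanAt i
  · intro hc
    have hinj := altanEmb_injective (j := j) Q.R.inj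
    obtain ⟨x, hx⟩ := Cycle.exists_mem_of_ne_nil
      (fun h => hc.1 (by rw [h]; rfl) : c ≠ Cycle.nil)
    rcases x with x | ⟨u, b⟩
    · have hch := (Cycle.chain_map _).1 hc.2.2
      have hold : ∀ y ∈ c, ∃ z, y = Sum.inl z := by
        refine hch.forall_mem (p := fun y => ∃ z, y = Sum.inl z) ?_ hx ⟨x, rfl⟩
        rintro _ y - - h ⟨z, rfl⟩
        rw [Q.annulusData.boundaryRel_iff] at h
        rcases h with ⟨d, -, -, -, h⟩ | ⟨u, h, -⟩ | ⟨u, h, -⟩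
        · rcases y with y | y
          · exact ⟨y, rfl⟩
          · cases h
        · cases h
        · cases h
      obtain ⟨c, rfl⟩ := Cycle.exists_map_eq_of_forall_mem_range (f := Sum.inl) (c := c)
        fun y hy => by obtain ⟨z, rfl⟩ := hold y hy; exact ⟨z, rfl⟩
      have hrel : ∀ y z : S.Vert, Q.annulusData.altan.BoundaryRel (patch P (S.deg2 j))
          (altanEmb φ j (Sum.inl y)) (altanEmb φ j (Sum.inl z)) →
          M.BoundaryRel P (φ y) (φ z) ∧ y ∉ S.perimeter j := by
        intro y z h
        rw [Q.annulusData.boundaryRel_iff] at h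
        rcases h with ⟨d, h1, h2, h3, h4⟩ | ⟨u, h, -⟩ | ⟨u, h, -⟩
        · have h3 := (Sum.inl.inj h3).symm
          exact ⟨⟨d, h3, (Sum.inl.inj h4).symm, h1⟩, (Q.lab_eq_none_iff h1 h3).1 h2⟩
        · cases h
        · cases h
      have hch' := (Cycle.chain_map _).1 hch
      have hper : M.IsPerimeter P (c.map φ) := by
        refine ⟨fun h => ?_, (Cycle.nodup_map_iff Q.R.inj).2 (hc.2.1.of_map.of_map), ?_⟩
        · rw [Cycle.map_eq_nil] at h
          exact hc.1 (by rw [h]; rfl)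
        · rw [Cycle.chain_map]
          exact hch'.imp fun y z h => (hrel y z h).1
      obtain ⟨i, rfl⟩ := (Q.R.perimeter c).2 hper
      obtain ⟨y, hy, hxy⟩ := Cycle.mem_map.1 hx
      obtain ⟨z, -, hyz⟩ := Cycle.exists_rel_of_chain hch' hy
      have hij : i ≠ j := by
        rintro rfl
        exact (hrel y z hyz).2 hy
      refine ⟨i, ?_⟩
      rw [perimeter_altanAt, if_neg hij]
    · refine ⟨j, ?_⟩
      rw [perimeter_altanAt, if_pos rfl]
      exact Cycle.map_injective hinj (Q.isPerimeter_newPerimeter.eq_of_mem hc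
        (Cycle.mem_map.2 ⟨_, (Q.Z.mem_new _).2 ⟨(u, b), rfl⟩, rfl⟩) (Cycle.mem_map.2 ⟨_, hx, rfl⟩))

theorem altan_perimeter_injective (Q : M.PerimeterData P S φ j) :
    Function.Injective (S.altanAt j).perimeter := by
  have key : ∀ i, i ≠ j → S.newPerimeter j ≠ (S.perimeter i).map Sum.inl := by
    intro i _ h
    obtain ⟨x, hx⟩ := Cycle.exists_mem_of_ne_nil
      (fun h => (Q.R.isPerimeter j).1 (by rw [h]; rfl) : S.perimeter j ≠ Cycle.nil)
    obtain ⟨u, -⟩ := Q.Z.cover x hx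
    have := (Q.Z.mem_new (Sum.inr (u, false))).2 ⟨_, rfl⟩
    rw [h] at this
    obtain ⟨y, -, hy⟩ := Cycle.mem_map.1 this
    cases hy
  intro i i' h
  rw [perimeter_altanAt, perimeter_altanAt] at h
  split_ifs at h with h1 h2 h2
  · rw [h1, h2]
  · exact absurd h (key i' h2)
  · exact absurd h.symm (key i h1)
  · exact Q.R.perimeter_inj (Cycle.map_injective Sum.inl_injective h)

/-- The altan is realised by inserting a ring. -/
theorem realizes_altanAt : Q.annulusData.altan.Realizes (patch P (S.deg2 j)) (S.altanAt j)
    (altanEmb φ j) where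
  inj := altanEmb_injective Q.R.inj
  vert := Q.altan_vert
  adj := Q.altan_adj
  faces := Q.altan_faces
  perimeter_inj := Q.altan_perimeter_injective
  perimeter := Q.altan_perimeter

end PerimeterData
end CubicMap

/-! ### From plane cubic graphs to cubic maps. -/

theorem Equiv.Perm.SameCycle.mem_of_forall {α : Type*} [Finite α] {f : Equiv.Perm α} {X : Set α}
    (hX : ∀ x ∈ X, f x ∈ X) {x y : α} (h : f.SameCycle x y) (hx : x ∈ X) : y ∈ X := by
  obtain ⟨i, -, rfl⟩ := h.exists_pow_eq'
  clear h
  induction i with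
  | zero => exact hx
  | succ i ih =>
    rw [pow_succ', Equiv.Perm.mul_apply]
    exact hX _ ih

namespace SimpleGraph

theorem two_mul_ncard_edgeSet_of_cubic {V : Type*} [Finite V] (H : SimpleGraph V)
    (h : ∀ v, (H.neighborSet v).ncard = 3) : 2 * H.edgeSet.ncard = 3 * Nat.card V := by
  classical
  have := Fintype.ofFinite V
  have h1 := H.sum_degrees_eq_twice_card_edges
  have h2 : ∀ v, H.degree v = 3 := by
    intro v
    rw [← h v, Set.ncard_eq_toFinset_card', ← SimpleGraph.card_neighborSet_eq_degree,
      Set.toFinset_card]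
  rw [Set.ncard_eq_toFinset_card', ← SimpleGraph.edgeFinset, ← h1]
  simp [h2, mul_comm]

theorem card_connectedComponent_eq {V : Type*} {H : SimpleGraph V} {r : V → V → Prop}
    (h : ∀ u v, H.Adj u v ↔ r u v) : Nat.card H.ConnectedComponent = Nat.card (Quot r) := by
  refine Nat.card_congr ⟨Quot.lift (Quot.mk r) ?_, Quot.lift H.connectedComponentMk ?_, ?_, ?_⟩
  · rintro u v ⟨p⟩
    induction p with
    | nil => rfl
    | cons hadj _ ih => exact (Quot.sound ((h _ _).1 hadj)).trans ih
  · intro u v huv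
    exact ConnectedComponent.sound ((h u v).2 huv).reachable
  · rintro ⟨v⟩; rfl
  · rintro ⟨v⟩; rfl

theorem fromRel_preconnected_iff {F : Type*} {r : F → F → Prop} (hr : ∀ a b, r a b → r b a) :
    (SimpleGraph.fromRel r).Preconnected ↔ ∀ a b, Relation.ReflTransGen r a b := by
  constructor
  · intro h a b
    have := (SimpleGraph.reachable_iff_reflTransGen a b).1 (h a b)
    refine this.lift id ?_
    rintro a b ⟨-, h | h⟩
    · exact h
    · exact hr _ _ h
  · intro h a b
    induction h a b with
    | refl => rfl
    | @tail b c _ hbc ih =>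
      -- An edge may have the same face on both sides; such loops of the relation are not edges of
      -- the simple graph.
      by_cases hne : b = c
      · rwa [← hne]
      · exact ih.trans (SimpleGraph.Adj.reachable ⟨hne, Or.inl hbc⟩)

theorem induce_fromRel_connected_iff {F : Type*} {r : F → F → Prop} (hr : ∀ a b, r a b → r b a)
    (Q : Set F) : ((SimpleGraph.fromRel r).induce Q).Connected ↔
      Q.Nonempty ∧ ∀ a ∈ Q, ∀ b ∈ Q,
        Relation.ReflTransGen (fun a b => a ∈ Q ∧ b ∈ Q ∧ r a b) a b := by
  constructor
  · intro h
    obtain ⟨⟨a, ha⟩⟩ := h.nonempty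
    refine ⟨⟨a, ha⟩, fun a ha b hb => ?_⟩
    have := (SimpleGraph.reachable_iff_reflTransGen _ _).1 (h.preconnected ⟨a, ha⟩ ⟨b, hb⟩)
    refine this.lift Subtype.val ?_
    rintro ⟨a, ha⟩ ⟨b, hb⟩ ⟨-, h | h⟩
    · exact ⟨ha, hb, h⟩
    · exact ⟨ha, hb, hr _ _ h⟩
  · rintro ⟨⟨a, ha⟩, h⟩
    have : Nonempty Q := ⟨⟨a, ha⟩⟩
    refine ⟨?_⟩
    rintro ⟨a, ha⟩ ⟨b, hb⟩
    suffices H : ∀ b, Relation.ReflTransGen (fun a b => a ∈ Q ∧ b ∈ Q ∧ r a b) a b →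
        ∃ hb : b ∈ Q, ((SimpleGraph.fromRel r).induce Q).Reachable ⟨a, ha⟩ ⟨b, hb⟩ from
      (H b (h a ha b hb)).2
    intro b hab
    induction hab with
    | refl => exact ⟨ha, .refl _⟩
    | @tail b c _ hbc ih =>
      obtain ⟨hb, ih⟩ := ih
      refine ⟨hbc.2.1, ?_⟩
      by_cases hne : b = c
      · subst hne; exact ih
      · exact ih.trans (SimpleGraph.Adj.reachable
          (SimpleGraph.comap_adj.2 ⟨hne, Or.inl hbc.2.2⟩))

end SimpleGraph

namespace PlaneCubicGraph

variable {V F : Type u} (G : PlaneCubicGraph V F)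

theorem finite_dart (G : PlaneCubicGraph V F) : Finite G.graph.Dart := by
  have := G.finite_vert
  exact Finite.of_injective (fun d => d.toProd) fun d e h => SimpleGraph.Dart.ext _ _ h

theorem ncard_darts (v : V) : {d : G.graph.Dart | d.fst = v}.ncard = 3 := by
  rw [← G.cubic v]
  refine Set.ncard_congr (fun d _ => d.snd) ?_ ?_ ?_
  · rintro d rfl
    exact d.adj
  · rintro d e rfl he h
    exact SimpleGraph.Dart.ext _ _ (Prod.ext he.symm h)
  · intro w hw
    exact ⟨⟨(v, w), hw⟩, rfl, rfl⟩

theorem fst_rot (d : G.graph.Dart) : (G.rot d).fst = d.fst :=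
  ((G.sameCycle_rot_iff d (G.rot d)).1 ⟨1, by simp⟩).symm

/-- The three darts at a vertex form a single cycle of the rotation, so a non-empty invariant set
contains all three at some vertex. Applied to sets of one and of two darts, this shows that the
rotation has period exactly three at every dart. -/
theorem three_le_ncard_of_invariant {X : Set G.graph.Dart} (hX : ∀ x ∈ X, G.rot x ∈ X)
    {d : G.graph.Dart} (hd : d ∈ X) : 3 ≤ X.ncard := by
  have := G.finite_dart
  rw [← G.ncard_darts d.fst]
  refine Set.ncard_le_ncard fun e he => ?_
  exact ((G.sameCycle_rot_iff d e).2 (Eq.symm he)).mem_of_forall hX hd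

theorem rot_ne (d : G.graph.Dart) : G.rot d ≠ d := by
  intro h
  have := G.three_le_ncard_of_invariant (X := {d}) (by simpa using h) rfl
  rw [Set.ncard_singleton] at this
  lia

theorem rot_rot_ne (d : G.graph.Dart) : G.rot (G.rot d) ≠ d := by
  intro h
  have := G.three_le_ncard_of_invariant (X := {d, G.rot d}) (d := d) (by simp [h]) (by simp)
  rw [Set.ncard_pair (G.rot_ne d).symm] at this
  lia

theorem darts_eq (d : G.graph.Dart) :
    {d, G.rot d, G.rot (G.rot d)} = {e : G.graph.Dart | e.fst = d.fst} := by
  have := G.finite_dart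
  have h3 : ({d, G.rot d, G.rot (G.rot d)} : Set G.graph.Dart).ncard = 3 :=
    Set.ncard_eq_three.2 ⟨_, _, _, (G.rot_ne d).symm, (G.rot_rot_ne d).symm, (G.rot_ne _).symm, rfl⟩
  refine Set.eq_of_subset_of_ncard_le ?_ (by rw [h3, G.ncard_darts])
  rintro e (rfl | rfl | rfl)
  · rfl
  · exact G.fst_rot d
  · exact (G.fst_rot _).trans (G.fst_rot d)

theorem eq_of_fst_eq {d e : G.graph.Dart} (h : d.fst = e.fst) :
    e = d ∨ e = G.rot d ∨ e = G.rot (G.rot d) := by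
  have : e ∈ {e : G.graph.Dart | e.fst = d.fst} := h.symm
  rw [← G.darts_eq] at this
  simpa using this

theorem rot_rot_rot (d : G.graph.Dart) : G.rot (G.rot (G.rot d)) = d := by
  rcases G.eq_of_fst_eq (d := d) (e := G.rot (G.rot (G.rot d)))
    (by rw [G.fst_rot, G.fst_rot, G.fst_rot]) with h | h | h
  · exact h
  · exact absurd (G.rot.injective h) (G.rot_rot_ne d)
  · exact absurd h (G.rot_ne _)

theorem dual_symm (a b : F) (h : ∃ d, G.face d = a ∧ G.face d.symm = b) :
    ∃ d, G.face d = b ∧ G.face d.symm = a := by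
  obtain ⟨d, h1, h2⟩ := h
  exact ⟨d.symm, h2, by rwa [SimpleGraph.Dart.symm_symm]⟩

theorem adj_iff (u v : V) : G.graph.Adj u v ↔ ∃ d : G.graph.Dart, d.fst = u ∧ d.symm.fst = v :=
  ⟨fun h => ⟨⟨(u, v), h⟩, rfl, rfl⟩, by rintro ⟨d, rfl, rfl⟩; exact d.adj⟩

/-- A plane cubic graph with its darts. -/
def toCubicMap : CubicMap V F G.graph.Dart where
  finite_vert := G.finite_vert
  inv := SimpleGraph.Dart.symm
  inv_inv := SimpleGraph.Dart.symm_symm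
  rot := G.rot
  tail d := d.fst
  face := G.face
  tail_inj _ _ h h' := SimpleGraph.Dart.ext _ _ (Prod.ext h h')
  tail_inv_ne d := d.adj.ne'
  rot_rot_rot := G.rot_rot_rot
  rot_ne := G.rot_ne
  tail_rot := G.fst_rot
  eq_of_tail_eq _ _ := G.eq_of_fst_eq
  tail_surj v := by
    have : {d : G.graph.Dart | d.fst = v}.Nonempty :=
      Set.nonempty_of_ncard_ne_zero (by rw [G.ncard_darts]; lia)
    exact this
  face_surj := G.face_surjective
  face_rot_inv := G.face_rot_symm
  dual_conn := (SimpleGraph.fromRel_preconnected_iff G.dual_symm).1 G.dual_preconnected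
  euler := by
    have := G.finite_vert
    have h1 := G.euler
    -- Doubling Euler's formula and substituting 2|E| = 3|V| eliminates the edges.
    have h2 := SimpleGraph.two_mul_ncard_edgeSet_of_cubic G.graph G.cubic
    have h3 := SimpleGraph.card_connectedComponent_eq G.adj_iff
    rw [← h3]
    lia

theorem dualConnected_iff (Q : Set F) :
    (G.dual.induce Q).Connected ↔ G.toCubicMap.DualConnected Q :=
  SimpleGraph.induce_fromRel_connected_iff G.dual_symm Q

theorem isPerforatedPatch_iff (P : Set F) :
    G.IsPerforatedPatch P ↔ G.toCubicMap.IsPerforatedPatch P :=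
  and_congr Iff.rfl (G.dualConnected_iff P)

theorem isPerimeter_iff (P : Set F) (c : Cycle (G.skeleton P).verts) :
    G.IsPerimeter P c ↔ G.toCubicMap.IsPerimeter P (c.map Subtype.val) := by
  have h : c.map Subtype.val = Cycle.nil ↔ c = Cycle.nil := Cycle.map_eq_nil _ _
  rw [IsPerimeter, CubicMap.IsPerimeter, Ne, Ne, h, Cycle.nodup_map_iff Subtype.val_injective,
    Cycle.chain_map]
  rfl

theorem realizes_complex {P : Set F} {k : ℕ} {C : Fin k → Cycle (G.skeleton P).verts}
    (hC : G.IsPerimeterLabelling P C) :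
    G.toCubicMap.Realizes P (G.complex P C) (Subtype.val : (G.skeleton P).verts → V) where
  inj := Subtype.val_injective
  vert v := by
    change v ∈ Set.range (Subtype.val : (G.skeleton P).verts → V) ↔ _
    rw [Subtype.range_val]
    rfl
  adj _ _ := Iff.rfl
  faces _ := Iff.rfl
  perimeter_inj := hC.1
  perimeter c := (Set.ext_iff.1 hC.2 c).trans (G.isPerimeter_iff P c)

end PlaneCubicGraph

/-! ### From cubic maps back to plane cubic graphs. -/

namespace CubicMap

variable {V F D : Type u} (M : CubicMap V F D)

/-- The graph of a cubic map. -/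
def graph : SimpleGraph V where
  Adj u v := ∃ d, M.tail d = u ∧ M.tail (M.inv d) = v
  symm := ⟨by
    rintro u v ⟨d, rfl, rfl⟩
    exact ⟨M.inv d, rfl, by rw [M.inv_inv]⟩⟩
  loopless := ⟨by
    rintro u ⟨d, h1, h2⟩
    exact M.tail_inv_ne d (h2.trans h1.symm)⟩

/-- The abstract darts are the darts of the graph. -/
noncomputable def dartEquiv : D ≃ M.graph.Dart :=
  Equiv.ofBijective (fun d => ⟨(M.tail d, M.tail (M.inv d)), d, rfl, rfl⟩) ⟨by
    intro d e h
    have := congrArg SimpleGraph.Dart.toProd h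
    exact M.tail_inj d e (Prod.ext_iff.1 this).1 (Prod.ext_iff.1 this).2, by
    rintro ⟨⟨u, v⟩, d, h, h'⟩
    exact ⟨d, SimpleGraph.Dart.ext _ _ (Prod.ext h h')⟩⟩

theorem symm_dartEquiv (d : D) : (M.dartEquiv d).symm = M.dartEquiv (M.inv d) :=
  SimpleGraph.Dart.ext _ _ (Prod.ext rfl (by
    change M.tail d = M.tail (M.inv (M.inv d))
    rw [M.inv_inv]))

/-- The rotation as a permutation. -/
def rotPerm : Equiv.Perm D where
  toFun := M.rot
  invFun d := M.rot (M.rot d)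
  left_inv := M.rot_rot_rot
  right_inv := M.rot_rot_rot

theorem forall_dart {p : M.graph.Dart → Prop} (h : ∀ d, p (M.dartEquiv d)) (d : M.graph.Dart) :
    p d := by
  rw [← M.dartEquiv.apply_symm_apply d]
  exact h _

theorem exists_dart {p : M.graph.Dart → Prop} : (∃ d, p d) ↔ ∃ d, p (M.dartEquiv d) :=
  M.dartEquiv.surjective.exists

theorem cubic (v : V) : (M.graph.neighborSet v).ncard = 3 := by
  obtain ⟨b, rfl⟩ := M.tail_surj v
  rw [← Set.ncard_eq_three.2 ⟨b, M.rot b, M.rot (M.rot b), (M.rot_ne b).symm,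
    (M.rot_rot_ne b).symm, (M.rot_ne _).symm, rfl⟩]
  refine (Set.ncard_congr (fun d _ => M.tail (M.inv d)) ?_ ?_ ?_).symm
  · rintro d (rfl | rfl | rfl)
    · exact ⟨d, rfl, rfl⟩
    · exact ⟨_, M.tail_rot b, rfl⟩
    · exact ⟨_, (M.tail_rot _).trans (M.tail_rot b), rfl⟩
  · have h : ∀ d ∈ ({b, M.rot b, M.rot (M.rot b)} : Set D), M.tail d = M.tail b := by
      rintro d (rfl | rfl | rfl)
      · rfl
      · exact M.tail_rot b
      · exact (M.tail_rot _).trans (M.tail_rot b)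
    intro d e hd he hde
    exact M.tail_inj d e ((h d hd).trans (h e he).symm) hde
  · rintro w ⟨d, h1, rfl⟩
    refine ⟨d, ?_, rfl⟩
    rcases M.eq_of_tail_eq b d h1.symm with h | h | h <;> simp [h]

/-- The plane cubic graph of a cubic map. -/
noncomputable def toPlane : PlaneCubicGraph V F where
  graph := M.graph
  finite_vert := M.finite_vert
  cubic := M.cubic
  rot := (M.dartEquiv.symm.trans M.rotPerm).trans M.dartEquiv
  sameCycle_rot_iff := by
    have hr : ∀ d, ((M.dartEquiv.symm.trans M.rotPerm).trans M.dartEquiv) (M.dartEquiv d) =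
        M.dartEquiv (M.rot d) := fun d => by simp [rotPerm]
    refine M.forall_dart fun d => M.forall_dart fun e => ?_
    constructor
    · intro h
      have := M.finite_darts
      have : Finite M.graph.Dart := Finite.of_equiv D M.dartEquiv
      have hd : M.dartEquiv d ∈ {x : M.graph.Dart | (M.dartEquiv d).fst = x.fst} := rfl
      refine h.mem_of_forall ?_ hd
      refine M.forall_dart fun e he => ?_
      rw [hr]
      exact Eq.trans he (M.tail_rot e).symm
    · intro h
      rcases M.eq_of_tail_eq d e h with rfl | rfl | rfl
      · exact .refl _ _
      · exact ⟨1, by rw [zpow_one, hr]⟩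
      · exact ⟨2, by rw [zpow_ofNat, pow_two, Equiv.Perm.mul_apply, hr, hr]⟩
  face d := M.face (M.dartEquiv.symm d)
  face_surjective f := by
    obtain ⟨d, rfl⟩ := M.face_surj f
    exact ⟨M.dartEquiv d, by simp⟩
  face_rot_symm := by
    refine M.forall_dart fun d => ?_
    rw [M.symm_dartEquiv]
    simp [rotPerm, M.face_rot_inv]
  dual_preconnected := by
    have h : (fun a b : F => ∃ d, M.face (M.dartEquiv.symm d) = a ∧
        M.face (M.dartEquiv.symm d.symm) = b) = fun a b => ∃ d, M.face d = a ∧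
          M.face (M.inv d) = b := by
      ext a b
      rw [M.exists_dart]
      simp [M.symm_dartEquiv]
    rw [h, SimpleGraph.fromRel_preconnected_iff]
    · exact M.dual_conn
    · rintro _ _ ⟨d, rfl, rfl⟩
      exact ⟨M.inv d, rfl, by rw [M.inv_inv]⟩
  euler := by
    have := M.finite_vert
    have h1 := M.euler
    have h2 := SimpleGraph.two_mul_ncard_edgeSet_of_cubic M.graph M.cubic
    have h3 := SimpleGraph.card_connectedComponent_eq (H := M.graph) (fun u v => Iff.rfl)
    change Nat.card M.graph.ConnectedComponent =
      Nat.card (Quot fun u v => ∃ d, M.tail d = u ∧ M.tail (M.inv d) = v) at h3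
    rw [← h3] at h1
    lia

/-- The abstract darts are the darts of the plane cubic graph. -/
noncomputable def planeDart : D ≃ M.toPlane.graph.Dart := M.dartEquiv

theorem symm_planeDart (d : D) : (M.planeDart d).symm = M.planeDart (M.inv d) := M.symm_dartEquiv d

theorem face_planeDart (d : D) : M.toPlane.face (M.planeDart d) = M.face d :=
  congrArg M.face (M.dartEquiv.symm_apply_apply d)

theorem rot_planeDart (d : D) : M.toPlane.rot (M.planeDart d) = M.planeDart (M.rot d) :=
  congrArg (fun d => M.dartEquiv (M.rot d)) (M.dartEquiv.symm_apply_apply d)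

theorem exists_planeDart {p : M.toPlane.graph.Dart → Prop} :
    (∃ d, p d) ↔ ∃ d, p (M.planeDart d) := M.planeDart.surjective.exists

theorem toPlane_dualConnected_iff (Q : Set F) :
    (M.toPlane.dual.induce Q).Connected ↔ M.DualConnected Q := by
  rw [PlaneCubicGraph.dualConnected_iff]
  have h : ∀ a b, (∃ d, M.toPlane.face d = a ∧ M.toPlane.face d.symm = b) ↔
      ∃ d, M.face d = a ∧ M.face (M.inv d) = b := by
    intro a b
    rw [M.exists_planeDart]
    simp only [face_planeDart, symm_planeDart]
  change (_ ∧ ∀ a ∈ Q, ∀ b ∈ Q, Relation.ReflTransGen (fun a b => a ∈ Q ∧ b ∈ Q ∧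
    ∃ d, M.toPlane.face d = a ∧ M.toPlane.face d.symm = b) a b) ↔ _
  simp only [h]
  rfl

theorem toPlane_isPerforatedPatch_iff (P : Set F) :
    M.toPlane.IsPerforatedPatch P ↔ M.IsPerforatedPatch P :=
  and_congr Iff.rfl (M.toPlane_dualConnected_iff P)

theorem toPlane_isFacialWalk_iff (f : F) (c : Cycle V) :
    M.toPlane.IsFacialWalk f c ↔ M.IsFacialWalk f c := by
  constructor
  · rintro ⟨w, h1, h2, h3, h4, rfl⟩
    obtain ⟨w, rfl⟩ := Cycle.exists_map_eq_of_forall_mem_range (f := M.planeDart) (c := w)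
      fun x _ => M.planeDart.surjective x
    refine ⟨w, fun h => h1 (by rw [h]; rfl), h2.of_map, ?_, ?_, ?_⟩
    · refine ((Cycle.chain_map _).1 h3).imp fun d e h => ?_
      rw [M.symm_planeDart, rot_planeDart] at h
      exact M.planeDart.injective h
    · intro d hd
      rw [← M.face_planeDart]
      exact h4 _ (Cycle.mem_map.2 ⟨d, hd, rfl⟩)
    · exact Cycle.map_map _ _ w
  · rintro ⟨w, h1, h2, h3, h4, rfl⟩
    refine ⟨w.map M.planeDart, fun h => h1 ((Cycle.map_eq_nil _ _).1 h), (Cycle.nodup_map_iff M.planeDart.injective).2 h2,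
      ?_, ?_, ?_⟩
    · refine (Cycle.chain_map _).2 (h3.imp ?_)
      rintro d _ rfl
      rw [M.symm_planeDart, rot_planeDart]
    · intro x hx
      obtain ⟨d, hd, rfl⟩ := Cycle.mem_map.1 hx
      rw [M.face_planeDart, h4 d hd]
    · exact (Cycle.map_map M.planeDart (fun d => d.fst) w).symm

theorem toPlane_isPerimeter_iff (P : Set F) (c : Cycle V) :
    M.toPlane.toCubicMap.IsPerimeter P c ↔ M.IsPerimeter P c := by
  have h : M.toPlane.toCubicMap.BoundaryRel P = M.BoundaryRel P := by
    ext u v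
    refine M.exists_planeDart.trans (exists_congr fun d => ?_)
    refine and_congr Iff.rfl (and_congr Iff.rfl (and_congr ?_ ?_))
    · exact not_congr (by rw [← M.face_planeDart]; rfl)
    · rw [← M.face_planeDart, ← M.symm_planeDart]; rfl
  rw [IsPerimeter, h]
  rfl

theorem mem_toPlane_skeleton_iff (P : Set F) (v : V) :
    v ∈ (M.toPlane.skeleton P).verts ↔ ∃ d, M.tail d = v ∧ M.face d ∈ P := by
  refine M.exists_planeDart.trans (exists_congr fun d => ?_)
  rw [M.face_planeDart]
  rfl

theorem toPlane_skeleton_adj_iff (P : Set F) (u v : V) : (M.toPlane.skeleton P).Adj u v ↔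
    ∃ d, M.tail d = u ∧ M.tail (M.inv d) = v ∧ (M.face d ∈ P ∨ M.face (M.inv d) ∈ P) := by
  refine M.exists_planeDart.trans (exists_congr fun d => ?_)
  rw [M.symm_planeDart, M.face_planeDart, M.face_planeDart]
  rfl

variable {M} {P : Set F} {k : ℕ} {S : HoledComplex.{u} k} {φ : S.Vert → V}

/-- A realised complex is the complex of a set of faces of a plane cubic graph. -/
theorem Realizes.exists_labelling (R : M.Realizes P S φ) :
    ∃ C : Fin k → Cycle (M.toPlane.skeleton P).verts, M.toPlane.IsPerimeterLabelling P C ∧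
      (M.toPlane.complex P C).Isomorphic S := by
  have hv : ∀ x, φ x ∈ (M.toPlane.skeleton P).verts := fun x =>
    (M.mem_toPlane_skeleton_iff P _).2 ((R.vert _).1 ⟨x, rfl⟩)
  let ψ : S.Vert ≃ (M.toPlane.skeleton P).verts :=
    Equiv.ofBijective (fun x => ⟨φ x, hv x⟩) ⟨fun x y h => R.inj (congrArg Subtype.val h), by
      rintro ⟨v, h⟩
      obtain ⟨x, rfl⟩ := (R.vert v).2 ((M.mem_toPlane_skeleton_iff P v).1 h)
      exact ⟨x, rfl⟩⟩
  have hψ : ∀ c : Cycle S.Vert, (c.map ψ).map Subtype.val = c.map φ := fun c =>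
    Cycle.map_map _ _ _
  have h1 : ∀ c : Cycle S.Vert, (c.map ψ).map ψ.symm = c := fun c => by
    rw [Cycle.map_map, ψ.symm_comp_self]
    induction c using Quotient.inductionOn with
    | _ l => exact congrArg Cycle.ofList (List.map_id l)
  have h2 : ∀ c : Cycle (M.toPlane.skeleton P).verts, (c.map ψ.symm).map ψ = c := fun c => by
    rw [Cycle.map_map, ψ.self_comp_symm]
    induction c using Quotient.inductionOn with
    | _ l => exact congrArg Cycle.ofList (List.map_id l)
  refine ⟨fun i => (S.perimeter i).map ψ, ⟨fun i i' h =>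
    R.perimeter_inj (Cycle.map_injective ψ.injective h), ?_⟩, ⟨ψ.symm, ?_⟩, ?_, ?_⟩
  · ext c
    change _ ↔ M.toPlane.IsPerimeter P c
    rw [M.toPlane.isPerimeter_iff, toPlane_isPerimeter_iff]
    rw [← h2 c, hψ, ← R.perimeter]
    exact exists_congr fun i => ⟨fun h => Cycle.map_injective ψ.injective h, fun h => by
      change (S.perimeter i).map ψ = _
      rw [h]⟩
  · intro x y
    obtain ⟨x, rfl⟩ := ψ.surjective x
    obtain ⟨y, rfl⟩ := ψ.surjective y
    have h3 := (R.adj x y).trans (M.toPlane_skeleton_adj_iff P (φ x) (φ y)).symm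
    change S.graph.Adj (ψ.symm (ψ x)) (ψ.symm (ψ y)) ↔ (M.toPlane.skeleton P).Adj (φ x) (φ y)
    rwa [show ψ.symm (ψ x) = x from ψ.symm_apply_apply x,
      show ψ.symm (ψ y) = y from ψ.symm_apply_apply y]
  · have h3 : ∀ f, {c | M.IsFacialWalk f (c.map φ)} = Cycle.map ψ.symm ''
        {c : Cycle (M.toPlane.skeleton P).verts |
          M.toPlane.IsFacialWalk f (c.map Subtype.val)} := by
      intro f
      ext c
      constructor
      · intro h
        refine ⟨c.map ψ, ?_, h1 c⟩
        change M.toPlane.IsFacialWalk f ((c.map ψ).map Subtype.val)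
        rwa [hψ, toPlane_isFacialWalk_iff]
      · rintro ⟨c, h, rfl⟩
        change M.IsFacialWalk f ((c.map ψ.symm).map φ)
        rw [← hψ, h2, ← toPlane_isFacialWalk_iff]
        exact h
    ext s
    rw [R.faces]
    constructor
    · rintro ⟨f, hf, rfl⟩
      exact ⟨_, ⟨f, hf, rfl⟩, (h3 f).symm⟩
    · rintro ⟨_, ⟨f, hf, rfl⟩, rfl⟩
      exact ⟨f, hf, (h3 f).symm⟩
  · intro i
    exact (h1 _).symm

end CubicMap

/-! ### The invariant of the iteration and the theorem. -/

namespace HoledComplex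

variable {k : ℕ}

/-- `S` is realised by a perforated patch, which is a patch if `p` holds; it is 2-connected if `q`
holds, and its cycles with `n i > 0` contain at least two vertices of degree 2. -/
structure Admissible (p q : Prop) (n : Fin k → ℕ) (S : HoledComplex.{u} k) : Prop where
  realizable : ∃ (V F D : Type u) (M : CubicMap V F D) (P : Set F) (φ : S.Vert → V),
    M.IsPerforatedPatch P ∧ (p → M.DualConnected Pᶜ) ∧ M.Realizes P S φ
  twoConnected : q → S.graph.TwoConnected
  two_le : ∀ i, 0 < n i → 2 ≤ (S.deg2 i).ncard

/-- Within one round `n` is kept fixed: the cycles still waiting for their altan must keep two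
degree-2 vertices, and so must the new cycle for the later rounds. -/
theorem Admissible.altanAt {p q : Prop} {n : Fin k → ℕ} {S : HoledComplex.{u} k}
    (h : S.Admissible p q n) {j : Fin k} (hj : 0 < n j) : (S.altanAt j).Admissible p q n := by
  obtain ⟨⟨V, F, D, M, P, φ, h1, h2, R⟩, h3, h4⟩ := h
  obtain ⟨Z⟩ := S.exists_segments j (R.nodup j) (h4 j hj)
  obtain ⟨b, hb⟩ := R.exists_boundary j
  let Q : M.PerimeterData P S φ j := ⟨R, Z, b, fun x hx => (hb x hx).1, fun x hx => (hb x hx).2⟩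
  have := R.finite_vert
  exact ⟨⟨_, _, _, Q.annulusData.altan, _, _, Q.annulusData.isPerforatedPatch_altan h1,
    fun hp => Q.annulusData.dualConnected_compl_altan (h2 hp), Q.realizes_altanAt⟩,
    fun hq => Z.twoConnected_altanGraph (h3 hq),
    fun i hi => Z.two_le_ncard_deg2 (h4 j hj) (fun i hi => R.disjoint hi) i (h4 i hi)⟩

theorem Admissible.altan {p q : Prop} {n : Fin k → ℕ} {S : HoledComplex.{u} k}
    (h : S.Admissible p q n) {J : Finset (Fin k)} (hJ : ∀ j ∈ J, 0 < n j) :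
    (S.altan J).Admissible p q n := by
  have key : ∀ (l : List (Fin k)) (S : HoledComplex.{u} k), (∀ j ∈ l, 0 < n j) →
      S.Admissible p q n → (l.foldl HoledComplex.altanAt S).Admissible p q n := by
    intro l
    induction l with
    | nil => exact fun S _ h => h
    | cons j l ih =>
      intro S hl h
      exact ih _ (fun i hi => hl i (by simp [hi])) (h.altanAt (hl j (by simp)))
  exact key _ _ (fun j hj => hJ j ((Finset.mem_sort _).1 hj)) h

theorem Admissible.iteratedAltan {p q : Prop} {n : Fin k → ℕ} {S : HoledComplex.{u} k}
    (h : S.Admissible p q n) : (S.iteratedAltan n).Admissible p q 0 := by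
  induction n, S using HoledComplex.iteratedAltan.induct with
  | case1 S =>
    rw [HoledComplex.iteratedAltan, if_pos rfl]
    exact h
  | case2 n S hn ih =>
    rw [HoledComplex.iteratedAltan, if_neg hn]
    have h' := h.altan (J := Finset.univ.filter fun i => 0 < n i) (by simp)
    -- Lowering `n` only weakens the requirement on degrees, since `n i - 1 > 0` implies `n i > 0`.
    exact ih ⟨h'.realizable, h'.twoConnected, fun i hi => h'.two_le i (by lia)⟩

end HoledComplex

theorem mainTheorem6 {V F : Type u} (G : PlaneCubicGraph V F) (P : Set F)
    (hP : G.IsPerforatedPatch P) {k : ℕ} (C : Fin k → Cycle (G.skeleton P).verts)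
    (hC : G.IsPerimeterLabelling P C) (n : Fin k → ℕ)
    (hn : ∀ i, 0 < n i → 2 ≤ ((G.complex P C).deg2 i).ncard) :
    ((G.complex P C).iteratedAltan n).IsPerforatedPatch ∧
    ((G.skeleton P).coe.TwoConnected →
      ((G.complex P C).iteratedAltan n).graph.TwoConnected) ∧
    (G.IsPatch P → ((G.complex P C).iteratedAltan n).IsPatch) := by
  -- The hypotheses of the second and third claims enter as the propositions `q` and `p`, so that
  -- one induction proves all three claims for the same map and set of faces.
  have h : (G.complex P C).Admissible (G.IsPatch P) (G.skeleton P).coe.TwoConnected n :=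
    ⟨⟨V, F, _, G.toCubicMap, P, _, (G.isPerforatedPatch_iff P).1 hP,
      fun h => (G.dualConnected_iff _).1 h.2, G.realizes_complex hC⟩, id, hn⟩
  obtain ⟨⟨V', F', D', M, P', φ, h1, h2, R⟩, h3, -⟩ := h.iteratedAltan
  obtain ⟨C', hC', hiso⟩ := R.exists_labelling
  have hP' := (M.toPlane_isPerforatedPatch_iff P').2 h1
  exact ⟨⟨V', F', M.toPlane, P', C', hP', hC', hiso⟩, h3, fun hp =>
    ⟨V', F', M.toPlane, P', C', ⟨hP', (M.toPlane_dualConnected_iff _).2 (h2 hp)⟩, hC', hiso⟩⟩
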